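/- Theorem 2. Let $\widetilde M(\mu)$ be a complex space form, i.e. a Kähler manifold $(\widetilde M,g,J)$ of constant holomorphic sectional curvature $\mu\in\mathbb R$ (no completeness is assumed), with Levi-Civita connection $\widetilde\nabla$. Let $M$ be a smooth (immersed) submanifold of $\widetilde M(\mu)$ with the induced metric, Levi-Civita connection $\nabla$, curvature tensor $R$ and scalar curvature $\tau$ (the full trace of $R$). Let $\sigma$ be its second fundamental form, $\sigma(X,Y)=(\widetilde\nabla_XY)^{\perp}$, let $D_X\xi=(\widetilde\nabla_X\xi)^{\perp}$ be the normal connection, with curvature tensor $R^\perp$, and for a normal vector $\xi$ let $f\xi$ be the normal component of $J\xi$. Assume that (a) $M$ is totally real: $J(T_pM)\subset (T_pM)^\perp$ for every $p\in M$; (b) $M$ is minimal: $\operatorname{tr}\sigma=0$; (c) $M$ is semiparallel: $R^\perp(X,Y)\sigma(Z,U)-\sigma(R(X,Y)Z,U)-\sigma(Z,R(X,Y)U)=0$ for all tangent $X,Y,Z,U$; (d) the $f$-structure in the normal bundle is parallel: $D_X(f\xi)=f(D_X\xi)$ for all tangent fields $X$ and normal fields $\xi$ (the case $f=0$ is allowed).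 Then the squared length $\|\sigma\|^2$ of the second fundamental form is constant on $M$ if and only if $\tau$ is constant on $M$. If this is the case, then $M$ is totally geodesic (i.e. $\sigma=0$) or $\tau\ge 0$; moreover, if $\tau=0$, then $M$ is flat (i.e. $R=0$). -/

import Mathlib

open scoped Manifold ContDiff Topology
open Bundle Filter

noncomputable section

namespace TotReal

/-! ### Local Riemannian geometry in a coordinate domain -/

section Local

variable {V : Type*} [NormedAddCommGroup V] [NormedSpace ℝ V] [FiniteDimensional ℝ V]
variable {W : Type*} [NormedAddCommGroup W] [NormedSpace ℝ W] [FiniteDimensional ℝ W]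

/-- The Christoffel symbol `Γ_x(v, w)` of the metric `g`: the vector whose `g`-product with `t` is
`((∂_v g)(w, t) + (∂_w g)(v, t) - (∂_t g)(v, w)) / 2`. -/
def christoffel (g : V → V →L[ℝ] V →L[ℝ] ℝ) (x v w : V) : V :=
  (g x).inverse ((1 / 2 : ℝ) •
    (fderiv ℝ g x v w + fderiv ℝ g x w v - ((fderiv ℝ g x).flip v).flip w))

/-- The Levi-Civita derivative `∇_v Y` at `x` of a vector field `Y`. -/
def cov (g : V → V →L[ℝ] V →L[ℝ] ℝ) (Y : V → V) (x v : V) : V :=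
  fderiv ℝ Y x v + christoffel g x v (Y x)

/-- The curvature tensor `R_x(v, w) z = ∇_v ∇_w z - ∇_w ∇_v z`, computed on the constant
(coordinate) extensions of `v, w, z`; their brackets vanish. -/
def curv (g : V → V →L[ℝ] V →L[ℝ] ℝ) (x v w z : V) : V :=
  cov g (fun y => cov g (fun _ => z) y w) x v - cov g (fun y => cov g (fun _ => z) y v) x w

/-- The trace `∑ g^{ij} B(b_i, b_j)` of a bilinear map `B` with respect to an inner product `g`
(equal to `∑ B(e_i, e_i)` for every `g`-orthonormal basis `e`). The second argument is `b_i` with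
the index raised: `g.inverse` sends the dual basis covector `b^i` to `∑_j g^{ij} b_j`. -/
def metricTrace {Z : Type*} [AddCommMonoid Z] (g : V →L[ℝ] V →L[ℝ] ℝ) (B : V → V → Z) : Z :=
  ∑ i, B (Module.finBasis ℝ V i)
    (g.inverse (LinearMap.toContinuousLinearMap ((Module.finBasis ℝ V).coord i)))

/-- The Ricci tensor `Ric_x(v, w)`, the trace of `a ↦ R(a, v) w`. -/
def ricci (g : V → V →L[ℝ] V →L[ℝ] ℝ) (x v w : V) : ℝ :=
  metricTrace (g x) (fun a b => g x (curv g x a v w) b)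

/-- The scalar curvature. -/
def scalarCurv (g : V → V →L[ℝ] V →L[ℝ] ℝ) (x : V) : ℝ :=
  metricTrace (g x) (ricci g x)

/-- The sectional curvature of the plane spanned by `v` and `w`. -/
def sectionalCurv (g : V → V →L[ℝ] V →L[ℝ] ℝ) (x v w : V) : ℝ :=
  g x (curv g x v w w) v / (g x v v * g x w w - g x v w ^ 2)

/-- The metric induced on `V` by `u : V → W` from the metric `G` on `W`. -/
def inducedMetric (G : W → W →L[ℝ] W →L[ℝ] ℝ) (u : V → W) (x : V) : V →L[ℝ] V →L[ℝ] ℝ :=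
  (G (u x)).bilinearComp (fderiv ℝ u x) (fderiv ℝ u x)

/-- The ambient Levi-Civita derivative `∇̃_v ξ` at `x` of a vector field `ξ` along `u`. -/
def covAlong (G : W → W →L[ℝ] W →L[ℝ] ℝ) (u : V → W) (ξ : V → W) (x v : V) : W :=
  fderiv ℝ ξ x v + christoffel G (u x) (fderiv ℝ u x v) (ξ x)

/-- The tangential component of `a` at `u x`, as a vector of `V`: the `t` such that
`G(du t, du s) = G(a, du s)` for all `s`. -/
def tangentialPart (G : W → W →L[ℝ] W →L[ℝ] ℝ) (u : V → W) (x : V) (a : W) : V :=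
  (inducedMetric G u x).inverse ((G (u x) a).comp (fderiv ℝ u x))

/-- The normal component of `a` at `u x`. -/
def normalPart (G : W → W →L[ℝ] W →L[ℝ] ℝ) (u : V → W) (x : V) (a : W) : W :=
  a - fderiv ℝ u x (tangentialPart G u x a)

/-- The second fundamental form `σ_x(v, w)`, the normal component of `∇̃_v (du w)`. -/
def sff (G : W → W →L[ℝ] W →L[ℝ] ℝ) (u : V → W) (x v w : V) : W :=
  normalPart G u x (covAlong G u (fun y => fderiv ℝ u y w) x v)

/-- The mean curvature vector `H = (1/n) tr σ`. -/
def meanCurv (G : W → W →L[ℝ] W →L[ℝ] ℝ) (u : V → W) (x : V) : W :=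
  (1 / (Module.finrank ℝ V : ℝ)) • metricTrace (inducedMetric G u x) (sff G u x)

/-- The squared length of the second fundamental form. -/
def sffNormSq (G : W → W →L[ℝ] W →L[ℝ] ℝ) (u : V → W) (x : V) : ℝ :=
  metricTrace (inducedMetric G u x) (fun v v' =>
    metricTrace (inducedMetric G u x) (fun w w' => G (u x) (sff G u x v w) (sff G u x v' w')))

/-- The normal connection `D_v ξ`, the normal component of `∇̃_v ξ`. -/
def normalCov (G : W → W →L[ℝ] W →L[ℝ] ℝ) (u : V → W) (ξ : V → W) (x v : V) : W :=
  normalPart G u x (covAlong G u ξ x v)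

/-- The curvature `R^⊥(v, w) ξ = D_v D_w ξ - D_w D_v ξ` of the normal connection, for the constant
(hence commuting) extensions of `v` and `w` and a normal field `ξ`. -/
def normalCurv (G : W → W →L[ℝ] W →L[ℝ] ℝ) (u : V → W) (ξ : V → W) (x v w : V) : W :=
  normalCov G u (fun y => normalCov G u ξ y w) x v
    - normalCov G u (fun y => normalCov G u ξ y v) x w

/-- `ξ` is a smooth normal vector field along `u` near `x`. -/
def IsNormalFieldAt (G : W → W →L[ℝ] W →L[ℝ] ℝ) (u : V → W) (ξ : V → W) (x : V) : Prop :=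
  ContDiffAt ℝ ∞ ξ x ∧ ∀ᶠ y in 𝓝 x, ∀ v : V, G (u y) (ξ y) (fderiv ℝ u y v) = 0

/-- `f a`, the normal component of `J a`. -/
def normalF (G : W → W →L[ℝ] W →L[ℝ] ℝ) (J : W → W →L[ℝ] W) (u : V → W) (x : V) (a : W) : W :=
  normalPart G u x (J (u x) a)

/-- `Df = 0` at `x`: `D_v (f ξ) = f (D_v ξ)` for all normal fields `ξ` and all `v`. -/
def ParallelFAt (G : W → W →L[ℝ] W →L[ℝ] ℝ) (J : W → W →L[ℝ] W) (u : V → W) (x : V) : Prop :=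
  ∀ ξ : V → W, IsNormalFieldAt G u ξ x → ∀ v : V,
    normalCov G u (fun y => normalF G J u y (ξ y)) x v = normalF G J u x (normalCov G u ξ x v)

/-- `R̄ · σ = 0` at `x`: `R^⊥(v, w) σ(z, t) - σ(R(v, w) z, t) - σ(z, R(v, w) t) = 0`, where `R` is
the curvature of the induced metric. -/
def SemiparallelAt (G : W → W →L[ℝ] W →L[ℝ] ℝ) (u : V → W) (x : V) : Prop :=
  ∀ v w z t : V,
    normalCurv G u (fun y => sff G u y z t) x v w
      - sff G u x (curv (inducedMetric G u) x v w z) t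
      - sff G u x z (curv (inducedMetric G u) x v w t) = 0

end Local

/-! ### Kähler manifolds and complex space forms -/

section Ambient

variable {E' : Type*} [NormedAddCommGroup E'] [NormedSpace ℝ E'] [FiniteDimensional ℝ E']
variable {N : Type*} [TopologicalSpace N] [ChartedSpace E' N] [IsManifold 𝓘(ℝ, E') ∞ N]

/-- The metric read in the preferred chart at `q`. -/
def chartMetric (g : ContMDiffRiemannianMetric 𝓘(ℝ, E') ∞ E' (fun q : N => TangentSpace 𝓘(ℝ, E') q))
    (q : N) (y : E') : E' →L[ℝ] E' →L[ℝ] ℝ :=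
  let B : E' →L[ℝ] E' →L[ℝ] ℝ := g.inner ((extChartAt 𝓘(ℝ, E') q).symm y)
  let L : E' →L[ℝ] E' := mfderiv 𝓘(ℝ, E') 𝓘(ℝ, E') (extChartAt 𝓘(ℝ, E') q).symm y
  B.bilinearComp L L

/-- A field of endomorphisms of the tangent spaces, read in the preferred chart at `q`. -/
def chartEnd (J : ∀ q : N, TangentSpace 𝓘(ℝ, E') q →L[ℝ] TangentSpace 𝓘(ℝ, E') q)
    (q : N) (y : E') : E' →L[ℝ] E' :=
  (mfderiv 𝓘(ℝ, E') 𝓘(ℝ, E') (extChartAt 𝓘(ℝ, E') q) ((extChartAt 𝓘(ℝ, E') q).symm y)).comp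
    ((J ((extChartAt 𝓘(ℝ, E') q).symm y)).comp
      (mfderiv 𝓘(ℝ, E') 𝓘(ℝ, E') (extChartAt 𝓘(ℝ, E') q).symm y))

/-- `(g, J)` is a Kähler structure on `N`: `J` is a smooth almost complex structure, `g` is
Hermitian, and `∇̃ J = 0` for the Levi-Civita connection of `g` (written in charts, on constant
fields: `∇̃_v (J w) = J (∇̃_v w)`). -/
structure IsKahler
    (g : ContMDiffRiemannianMetric 𝓘(ℝ, E') ∞ E' (fun q : N => TangentSpace 𝓘(ℝ, E') q))
    (J : ∀ q : N, TangentSpace 𝓘(ℝ, E') q →L[ℝ] TangentSpace 𝓘(ℝ, E') q) : Prop where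
  smooth : ContMDiff 𝓘(ℝ, E') (𝓘(ℝ, E').prod 𝓘(ℝ, E' →L[ℝ] E')) ∞
    (fun q => TotalSpace.mk' (E' →L[ℝ] E')
      (E := fun q : N => TangentSpace 𝓘(ℝ, E') q →L[ℝ] TangentSpace 𝓘(ℝ, E') q) q (J q))
  sq : ∀ (q : N) (a : TangentSpace 𝓘(ℝ, E') q), J q (J q a) = -a
  hermitian : ∀ (q : N) (a b : TangentSpace 𝓘(ℝ, E') q),
    g.inner q (J q a) (J q b) = g.inner q a b
  parallel : ∀ (q : N), ∀ y ∈ (extChartAt 𝓘(ℝ, E') q).target, ∀ v w : E',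
    cov (chartMetric g q) (fun y' => chartEnd J q y' w) y v
      = chartEnd J q y (cov (chartMetric g q) (fun _ => w) y v)

/-- `(N, g, J)` is a complex space form of constant holomorphic sectional curvature `μ`: it is
Kähler and every plane spanned by `a ≠ 0` and `J a` has sectional curvature `μ`. The tangent space
at `q` is identified with `E'` through the preferred chart at `q`. -/
structure IsComplexSpaceForm
    (g : ContMDiffRiemannianMetric 𝓘(ℝ, E') ∞ E' (fun q : N => TangentSpace 𝓘(ℝ, E') q))
    (J : ∀ q : N, TangentSpace 𝓘(ℝ, E') q →L[ℝ] TangentSpace 𝓘(ℝ, E') q) (μ : ℝ) : Prop where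
  kahler : IsKahler g J
  holomorphicCurv : ∀ (q : N) (a : TangentSpace 𝓘(ℝ, E') q), a ≠ 0 →
    sectionalCurv (chartMetric g q) (extChartAt 𝓘(ℝ, E') q q) a (J q a) = μ

end Ambient

/-! ### Submanifolds: immersions `F : M → N`, with the induced metric on `M` -/

section Submanifold

variable {E : Type*} [NormedAddCommGroup E] [NormedSpace ℝ E] [FiniteDimensional ℝ E]
variable {M : Type*} [TopologicalSpace M] [ChartedSpace E M] [IsManifold 𝓘(ℝ, E) ∞ M]
variable {E' : Type*} [NormedAddCommGroup E'] [NormedSpace ℝ E'] [FiniteDimensional ℝ E']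
variable {N : Type*} [TopologicalSpace N] [ChartedSpace E' N] [IsManifold 𝓘(ℝ, E') ∞ N]

/-- `F` is a smooth immersion. -/
def IsSmoothImmersion (F : M → N) : Prop :=
  ContMDiff 𝓘(ℝ, E) 𝓘(ℝ, E') ∞ F ∧
    ∀ p : M, Function.Injective (mfderiv 𝓘(ℝ, E) 𝓘(ℝ, E') F p)

/-- `J (T_p M)` is orthogonal to `T_p M` for every `p`. -/
def IsTotallyReal
    (g : ContMDiffRiemannianMetric 𝓘(ℝ, E') ∞ E' (fun q : N => TangentSpace 𝓘(ℝ, E') q))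
    (J : ∀ q : N, TangentSpace 𝓘(ℝ, E') q →L[ℝ] TangentSpace 𝓘(ℝ, E') q) (F : M → N) : Prop :=
  ∀ (p : M) (v w : TangentSpace 𝓘(ℝ, E) p),
    g.inner (F p) (J (F p) (mfderiv 𝓘(ℝ, E) 𝓘(ℝ, E') F p v)) (mfderiv 𝓘(ℝ, E) 𝓘(ℝ, E') F p w) = 0

/-- `H = 0`. -/
def IsMinimal
    (g : ContMDiffRiemannianMetric 𝓘(ℝ, E') ∞ E' (fun q : N => TangentSpace 𝓘(ℝ, E') q))
    (F : M → N) : Prop :=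
  ∀ p : M, meanCurv (chartMetric g (F p)) (writtenInExtChartAt 𝓘(ℝ, E) 𝓘(ℝ, E') p F)
    (extChartAt 𝓘(ℝ, E) p p) = 0

/-- `σ = 0`. -/
def IsTotallyGeodesic
    (g : ContMDiffRiemannianMetric 𝓘(ℝ, E') ∞ E' (fun q : N => TangentSpace 𝓘(ℝ, E') q))
    (F : M → N) : Prop :=
  ∀ (p : M) (v w : TangentSpace 𝓘(ℝ, E) p),
    sff (chartMetric g (F p)) (writtenInExtChartAt 𝓘(ℝ, E) 𝓘(ℝ, E') p F)
      (extChartAt 𝓘(ℝ, E) p p) v w = 0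

/-- `R̄ · σ = 0`. -/
def IsSemiparallel
    (g : ContMDiffRiemannianMetric 𝓘(ℝ, E') ∞ E' (fun q : N => TangentSpace 𝓘(ℝ, E') q))
    (F : M → N) : Prop :=
  ∀ p : M, SemiparallelAt (chartMetric g (F p)) (writtenInExtChartAt 𝓘(ℝ, E) 𝓘(ℝ, E') p F)
    (extChartAt 𝓘(ℝ, E) p p)

/-- The `f`-structure in the normal bundle is parallel, `Df = 0`. -/
def HasParallelF
    (g : ContMDiffRiemannianMetric 𝓘(ℝ, E') ∞ E' (fun q : N => TangentSpace 𝓘(ℝ, E') q))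
    (J : ∀ q : N, TangentSpace 𝓘(ℝ, E') q →L[ℝ] TangentSpace 𝓘(ℝ, E') q) (F : M → N) : Prop :=
  ∀ p : M, ParallelFAt (chartMetric g (F p)) (chartEnd J (F p))
    (writtenInExtChartAt 𝓘(ℝ, E) 𝓘(ℝ, E') p F) (extChartAt 𝓘(ℝ, E) p p)

/-- The squared length of the second fundamental form, as a function on `M`. -/
def sffLengthSq
    (g : ContMDiffRiemannianMetric 𝓘(ℝ, E') ∞ E' (fun q : N => TangentSpace 𝓘(ℝ, E') q))
    (F : M → N) (p : M) : ℝ :=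
  sffNormSq (chartMetric g (F p)) (writtenInExtChartAt 𝓘(ℝ, E) 𝓘(ℝ, E') p F)
    (extChartAt 𝓘(ℝ, E) p p)

/-- The scalar curvature of the induced metric, as a function on `M`. -/
def scalarCurvature
    (g : ContMDiffRiemannianMetric 𝓘(ℝ, E') ∞ E' (fun q : N => TangentSpace 𝓘(ℝ, E') q))
    (F : M → N) (p : M) : ℝ :=
  scalarCurv (inducedMetric (chartMetric g (F p)) (writtenInExtChartAt 𝓘(ℝ, E) 𝓘(ℝ, E') p F))
    (extChartAt 𝓘(ℝ, E) p p)

/-- The curvature tensor of the induced metric vanishes. -/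
def IsFlat
    (g : ContMDiffRiemannianMetric 𝓘(ℝ, E') ∞ E' (fun q : N => TangentSpace 𝓘(ℝ, E') q))
    (F : M → N) : Prop :=
  ∀ (p : M) (v w z : TangentSpace 𝓘(ℝ, E) p),
    curv (inducedMetric (chartMetric g (F p)) (writtenInExtChartAt 𝓘(ℝ, E) 𝓘(ℝ, E') p F))
      (extChartAt 𝓘(ℝ, E) p p) v w z = 0

end Submanifold

end TotReal

end

/-!
A normal field `J w` along a totally real submanifold of a Kähler manifold has normal component
`(J w)^⊥`; applying parallelism of `f` to it shows that `σ` takes its values in `J (TM)`, so that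
`⟨σ(v, w), J t⟩` is a totally symmetric cubic form `C`, trace-free by minimality. The Gauss equation
reads `R = c (v ∧ w) + [C w, C v]` with `c = μ / 4`, whence `τ = n (n - 1) c - S`, `S = ‖σ‖²`, and
this gives the equivalence.

By the Ricci equation semiparallelity is the algebraic condition `R · C = 0`, and tracing it yields
a Simons-type identity: the sum of `∑ ‖[C v, C w]‖²` and the squared norm of the Gram matrix
`tr (C v * C w)` is `(n + 1) c S`. Two Cauchy–Schwarz inequalities bound these terms from below:
`S² ≤ n ∑ (tr (C v * C w))²`, and `2 S² ≤ n (n - 1) ∑ ‖[C v, C w]‖²`, the discriminant inequality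
for the nonnegative quadratic polynomial `r ↦ ∑ ‖r (v ∧ w) + [C w, C v]‖²`. Hence
`S² ≤ n (n - 1) c S`, that is `S = 0` or `τ ≥ 0`. The same estimates with `S = n (n - 1) c` force
`‖R‖² ≤ 0`.
-/

noncomputable section

set_option maxSynthPendingDepth 3

namespace TotReal

section UnitCurv

variable {ι : Type*} [DecidableEq ι]

/-- The curvature operators of the metric of constant sectional curvature one, in an orthonormal
basis. -/
def unitCurv (v w : ι) : Matrix ι ι ℝ := Matrix.single w v 1 - Matrix.single v w 1

theorem conjTranspose_unitCurv (v w : ι) : (unitCurv v w).conjTranspose = -unitCurv v w := by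
  simp [unitCurv]

theorem unitCurv_apply (v w z t : ι) :
    unitCurv v w z t =
      (if w = z ∧ v = t then 1 else 0) - (if v = z ∧ w = t then 1 else 0) := by
  simp only [unitCurv, Matrix.sub_apply, Matrix.single_apply]

theorem unitCurv_apply_swap (v w z t : ι) : unitCurv v w z t = -unitCurv v w t z := by
  simpa using congrFun₂ (conjTranspose_unitCurv v w) t z

variable [Fintype ι]

theorem trace_mul_unitCurv (A : Matrix ι ι ℝ) (v w : ι) :
    (A * unitCurv v w).trace = A v w - A w v := by
  simp [unitCurv, mul_sub, Matrix.trace_mul_single]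

theorem sum_unitCurv_apply (w m : ι) :
    ∑ v, unitCurv v w v m = (1 - (Fintype.card ι : ℝ)) * if w = m then 1 else 0 := by
  by_cases h : w = m <;>
    simp [unitCurv_apply, Finset.sum_sub_distrib, ite_and, h]

theorem sum_sum_unitCurv_apply :
    ∑ v : ι, ∑ w : ι, unitCurv v w v w = Fintype.card ι * (1 - (Fintype.card ι : ℝ)) := by
  rw [Finset.sum_comm]
  simp only [sum_unitCurv_apply, if_true, mul_one, Finset.sum_const, Finset.card_univ, nsmul_eq_mul]

end UnitCurv

section CubicForms

variable {ι : Type*} [Fintype ι]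

/-- A totally symmetric trace-free cubic form, given by its components `C i j k` in an orthonormal
basis; the slices `C i` are the matrices of the shape operators. -/
structure IsHarmonicCubic (C : ι → Matrix ι ι ℝ) : Prop where
  symm₁₂ : ∀ i j k, C i j k = C j i k
  symm₂₃ : ∀ i j k, C i j k = C i k j
  trace : ∀ k, ∑ i, C i i k = 0

/-- The Gram matrix `tr (C i * C j)` of the slices of a symmetric cubic form. -/
def cubicGram (C : ι → Matrix ι ι ℝ) : Matrix ι ι ℝ :=
  Matrix.of fun i j => (C i * C j).trace

/-- The squared norm of a symmetric cubic form. -/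
def cubicNormSq (C : ι → Matrix ι ι ℝ) : ℝ := (cubicGram C).trace

theorem cubicNormSq_sq_le_card_mul (C : ι → Matrix ι ι ℝ) :
    cubicNormSq C ^ 2 ≤ Fintype.card ι * ∑ i, ∑ j, cubicGram C i j ^ 2 :=
  calc (∑ i, cubicGram C i i) ^ 2 ≤ Fintype.card ι * ∑ i, cubicGram C i i ^ 2 :=
        sq_sum_le_card_mul_sum_sq
    _ ≤ Fintype.card ι * ∑ i, ∑ j, cubicGram C i j ^ 2 := by
        gcongr with i
        exact Finset.single_le_sum (f := fun j => cubicGram C i j ^ 2)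
          (fun j _ => sq_nonneg _) (Finset.mem_univ i)

namespace IsHarmonicCubic

variable {C : ι → Matrix ι ι ℝ}

theorem isHermitian (h : IsHarmonicCubic C) (i : ι) : (C i).IsHermitian :=
  Matrix.IsHermitian.ext fun j k => h.symm₂₃ i k j

theorem conjTranspose_lie (h : IsHarmonicCubic C) (i j : ι) :
    ⁅C i, C j⁆.conjTranspose = -⁅C i, C j⁆ := by
  simp only [Ring.lie_def, Matrix.conjTranspose_sub, Matrix.conjTranspose_mul,
    (h.isHermitian _).eq, neg_sub]

theorem lie_apply_swap (h : IsHarmonicCubic C) (i j k l : ι) :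
    ⁅C i, C j⁆ k l = -⁅C i, C j⁆ l k := by
  simpa using congrFun₂ (h.conjTranspose_lie i j) l k

theorem cubicGram_self (h : IsHarmonicCubic C) (i : ι) :
    cubicGram C i i = (C i * (C i).conjTranspose).trace := by
  rw [(h.isHermitian i).eq, cubicGram, Matrix.of_apply]

theorem cubicGram_self_nonneg (h : IsHarmonicCubic C) (i : ι) : 0 ≤ cubicGram C i i :=
  (Matrix.posSemidef_self_mul_conjTranspose (C i)).trace_nonneg.trans_eq (h.cubicGram_self i).symm

theorem cubicNormSq_nonneg (h : IsHarmonicCubic C) : 0 ≤ cubicNormSq C :=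
  Finset.sum_nonneg fun i _ => h.cubicGram_self_nonneg i

theorem eq_zero_of_cubicNormSq (h : IsHarmonicCubic C) (h0 : cubicNormSq C = 0) (i : ι) :
    C i = 0 :=
  Matrix.trace_mul_conjTranspose_self_eq_zero_iff.1 <| (h.cubicGram_self i).symm.trans <|
    (Finset.sum_eq_zero_iff_of_nonneg fun i _ => h.cubicGram_self_nonneg i).1 h0 i
      (Finset.mem_univ i)

theorem sum_lie_apply (h : IsHarmonicCubic C) (j k : ι) :
    ∑ i, ⁅C j, C i⁆ i k = cubicGram C j k := by
  simp only [Ring.lie_def, Matrix.sub_apply, Matrix.mul_apply, Finset.sum_sub_distrib]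
  have htrace : ∑ i, ∑ m, C i i m * C j m k = 0 := by
    rw [Finset.sum_comm]
    simp only [← Finset.sum_mul, h.trace, zero_mul, Finset.sum_const_zero]
  rw [htrace, sub_zero, cubicGram, Matrix.of_apply, Matrix.trace]
  simp only [Matrix.diag, Matrix.mul_apply]
  refine Finset.sum_congr rfl fun i _ => Finset.sum_congr rfl fun m _ => ?_
  rw [h.symm₁₂ j i m, h.symm₂₃ i m k, h.symm₁₂ i k m, h.symm₂₃ k i m]

theorem sum_sum_lie_apply (h : IsHarmonicCubic C) : ∑ i, ∑ j, ⁅C j, C i⁆ i j = cubicNormSq C := by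
  rw [Finset.sum_comm]
  exact Finset.sum_congr rfl fun j _ => h.sum_lie_apply j j

end IsHarmonicCubic

/-- The algebraic semiparallelity `R · C = 0`, for the curvature operators `R v w` with matrix
entries `R v w z t = ⟨R(v, w) z, t⟩`. -/
def IsSemiparallelCubic (R : ι → ι → Matrix ι ι ℝ) (C : ι → Matrix ι ι ℝ) : Prop :=
  ∀ v w z, ⁅C z, R v w⁆ = ∑ m, R v w z m • C m

-- Put `z = v` in `R · C = 0`, multiply by `C w` and take traces.
theorem IsSemiparallelCubic.sum_trace_lie_mul {R : ι → ι → Matrix ι ι ℝ} {C : ι → Matrix ι ι ℝ}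
    (h : IsSemiparallelCubic R C) :
    ∑ v, ∑ w, (⁅C w, C v⁆ * R v w).trace = ∑ w, ∑ m, cubicGram C w m * ∑ v, R v w v m := by
  have htrace (v w : ι) :
      (⁅C w, C v⁆ * R v w).trace = ∑ m, cubicGram C w m * R v w v m := by
    calc (⁅C w, C v⁆ * R v w).trace = (C w * ⁅C v, R v w⁆).trace := by
          simp only [Ring.lie_def, sub_mul, mul_sub, Matrix.trace_sub, ← mul_assoc]
          rw [Matrix.trace_mul_cycle (C w) (R v w)]
      _ = ∑ m, cubicGram C w m * R v w v m := by
          simp only [h v w v, Matrix.mul_sum, Matrix.trace_sum, Matrix.mul_smul, Matrix.trace_smul,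
            smul_eq_mul, cubicGram, Matrix.of_apply, mul_comm]
  simp only [htrace, Finset.mul_sum]
  rw [Finset.sum_comm]
  exact Finset.sum_congr rfl fun w _ => Finset.sum_comm

variable [DecidableEq ι]

/-- The right-hand side of the Gauss equation of a totally real submanifold with cubic form `C` of
a space form: the curvature operators `c (v ∧ w) + [C w, C v]`. -/
def gaussCurv (c : ℝ) (C : ι → Matrix ι ι ℝ) (v w : ι) : Matrix ι ι ℝ :=
  c • unitCurv v w + ⁅C w, C v⁆

/-- The squared norm of the curvature tensor `gaussCurv c C`. -/
def gaussCurvNormSq (c : ℝ) (C : ι → Matrix ι ι ℝ) : ℝ :=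
  ∑ v, ∑ w, (gaussCurv c C v w * (gaussCurv c C v w).conjTranspose).trace

theorem gaussCurvNormSq_nonneg (c : ℝ) (C : ι → Matrix ι ι ℝ) : 0 ≤ gaussCurvNormSq c C :=
  Finset.sum_nonneg fun _ _ => Finset.sum_nonneg fun _ _ =>
    (Matrix.posSemidef_self_mul_conjTranspose _).trace_nonneg

theorem gaussCurv_eq_zero_of_normSq {c : ℝ} {C : ι → Matrix ι ι ℝ} (h : gaussCurvNormSq c C = 0)
    (v w : ι) : gaussCurv c C v w = 0 := by
  have hnonneg (v w : ι) : 0 ≤ (gaussCurv c C v w * (gaussCurv c C v w).conjTranspose).trace :=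
    (Matrix.posSemidef_self_mul_conjTranspose _).trace_nonneg
  have hv := (Finset.sum_eq_zero_iff_of_nonneg
    fun v _ => Finset.sum_nonneg fun w _ => hnonneg v w).1 h v (Finset.mem_univ v)
  exact Matrix.trace_mul_conjTranspose_self_eq_zero_iff.1
    ((Finset.sum_eq_zero_iff_of_nonneg fun w _ => hnonneg v w).1 hv w (Finset.mem_univ w))

namespace IsHarmonicCubic

variable {C : ι → Matrix ι ι ℝ}

theorem conjTranspose_gaussCurv (h : IsHarmonicCubic C) (c : ℝ) (v w : ι) :
    (gaussCurv c C v w).conjTranspose = -gaussCurv c C v w := by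
  simp only [gaussCurv, Matrix.conjTranspose_add, Matrix.conjTranspose_smul, h.conjTranspose_lie,
    conjTranspose_unitCurv, star_trivial, smul_neg, neg_add]

theorem gaussCurvNormSq_eq_neg_sum (h : IsHarmonicCubic C) (c : ℝ) :
    gaussCurvNormSq c C = -∑ v, ∑ w, (gaussCurv c C v w * gaussCurv c C v w).trace := by
  simp only [gaussCurvNormSq, h.conjTranspose_gaussCurv, mul_neg, Matrix.trace_neg,
    Finset.sum_neg_distrib]

theorem sum_gaussCurv_apply (h : IsHarmonicCubic C) (c : ℝ) :
    ∑ v, ∑ w, gaussCurv c C v w w v =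
      Fintype.card ι * (Fintype.card ι - 1) * c - cubicNormSq C := by
  have hswap (v w : ι) : gaussCurv c C v w w v = -gaussCurv c C v w v w := by
    simpa using congrFun₂ (h.conjTranspose_gaussCurv c v w) v w
  simp only [hswap, Finset.sum_neg_distrib]
  simp only [gaussCurv, Matrix.add_apply, Matrix.smul_apply, smul_eq_mul,
    Finset.sum_add_distrib, ← Finset.mul_sum, sum_sum_unitCurv_apply, h.sum_sum_lie_apply]
  ring

theorem sum_trace_lie_mul_unitCurv (h : IsHarmonicCubic C) :
    ∑ v, ∑ w, (⁅C w, C v⁆ * unitCurv v w).trace = 2 * cubicNormSq C := by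
  have hterm (v w : ι) : (⁅C w, C v⁆ * unitCurv v w).trace = 2 * ⁅C w, C v⁆ v w := by
    rw [trace_mul_unitCurv, h.lie_apply_swap w v w v]
    ring
  simp only [hterm, ← Finset.mul_sum, h.sum_sum_lie_apply]

theorem gaussCurvNormSq_eq (h : IsHarmonicCubic C) (c : ℝ) :
    gaussCurvNormSq c C = 2 * Fintype.card ι * (Fintype.card ι - 1) * c ^ 2 - 4 * c * cubicNormSq C
      + gaussCurvNormSq 0 C := by
  have hunit : ∑ v : ι, ∑ w : ι, (unitCurv v w * unitCurv v w).trace =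
      -(2 * Fintype.card ι * (Fintype.card ι - 1)) := by
    have hterm (v w : ι) : (unitCurv v w * unitCurv v w).trace = 2 * unitCurv v w v w := by
      rw [trace_mul_unitCurv, unitCurv_apply_swap v w w v]
      ring
    simp only [hterm, ← Finset.mul_sum, sum_sum_unitCurv_apply]
    ring
  have hterm (v w : ι) : (gaussCurv c C v w * gaussCurv c C v w).trace =
      c ^ 2 * (unitCurv v w * unitCurv v w).trace + 2 * c * (⁅C w, C v⁆ * unitCurv v w).trace
        + (gaussCurv 0 C v w * gaussCurv 0 C v w).trace := by
    simp only [gaussCurv, zero_smul, zero_add, mul_add, add_mul, Matrix.trace_add,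
      Matrix.mul_smul, Matrix.smul_mul, Matrix.trace_smul, smul_eq_mul,
      Matrix.trace_mul_comm (unitCurv v w) ⁅C w, C v⁆]
    ring
  simp only [h.gaussCurvNormSq_eq_neg_sum, hterm, Finset.sum_add_distrib, ← Finset.mul_sum, hunit,
    h.sum_trace_lie_mul_unitCurv]
  ring

theorem simons_identity (h : IsHarmonicCubic C) {c : ℝ}
    (hs : IsSemiparallelCubic (gaussCurv c C) C) :
    gaussCurvNormSq 0 C + ∑ i, ∑ j, cubicGram C i j ^ 2 =
      (Fintype.card ι + 1) * c * cubicNormSq C := by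
  have hleft : ∑ v, ∑ w, (⁅C w, C v⁆ * gaussCurv c C v w).trace =
      2 * c * cubicNormSq C - gaussCurvNormSq 0 C := by
    simp only [h.gaussCurvNormSq_eq_neg_sum, gaussCurv, zero_smul, zero_add, mul_add,
      Matrix.mul_smul, Matrix.trace_add, Matrix.trace_smul, smul_eq_mul, Finset.sum_add_distrib,
      ← Finset.mul_sum, h.sum_trace_lie_mul_unitCurv]
    ring
  have hricci (w m : ι) : ∑ v, gaussCurv c C v w v m =
      c * (1 - Fintype.card ι) * (if w = m then 1 else 0) + cubicGram C w m := by
    simp only [gaussCurv, Matrix.add_apply, Matrix.smul_apply, smul_eq_mul,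
      Finset.sum_add_distrib, ← Finset.mul_sum, sum_unitCurv_apply, h.sum_lie_apply, mul_assoc]
  have hright : ∑ w, ∑ m, cubicGram C w m * ∑ v, gaussCurv c C v w v m =
      c * (1 - Fintype.card ι) * cubicNormSq C + ∑ i, ∑ j, cubicGram C i j ^ 2 := by
    simp only [hricci, mul_add, Finset.sum_add_distrib, mul_ite, mul_one, mul_zero,
      Finset.sum_ite_eq, Finset.mem_univ, if_true, ← Finset.sum_mul, ← sq]
    rw [mul_comm (c * _), cubicNormSq, Matrix.trace]
    rfl
  linear_combination -hleft.symm.trans (hs.sum_trace_lie_mul.trans hright)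

theorem two_mul_cubicNormSq_sq_le (h : IsHarmonicCubic C) :
    2 * cubicNormSq C ^ 2 ≤ Fintype.card ι * (Fintype.card ι - 1) * gaussCurvNormSq 0 C := by
  have hquad (r : ℝ) : 0 ≤ 2 * Fintype.card ι * (Fintype.card ι - 1) * (r * r)
      + -4 * cubicNormSq C * r + gaussCurvNormSq 0 C :=
    (gaussCurvNormSq_nonneg r C).trans_eq (by rw [h.gaussCurvNormSq_eq]; ring)
  have := discrim_le_zero hquad
  rw [discrim] at this
  linarith

theorem cubicNormSq_sq_le (h : IsHarmonicCubic C) {c : ℝ}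
    (hs : IsSemiparallelCubic (gaussCurv c C) C) :
    cubicNormSq C ^ 2 ≤ Fintype.card ι * (Fintype.card ι - 1) * c * cubicNormSq C := by
  rcases isEmpty_or_nonempty ι with hι | hι
  · simp [cubicNormSq, Matrix.trace]
  have hcard : (1 : ℝ) ≤ Fintype.card ι := by exact_mod_cast Fintype.card_pos
  have hsimons := h.simons_identity hs
  have hgram := mul_le_mul_of_nonneg_left (cubicNormSq_sq_le_card_mul C) (sub_nonneg.2 hcard)
  have hcurv := h.two_mul_cubicNormSq_sq_le
  refine le_of_mul_le_mul_left ?_ (by linarith : (0 : ℝ) < Fintype.card ι + 1)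
  linear_combination hcurv + hgram + (Fintype.card ι : ℝ) * (Fintype.card ι - 1) * hsimons

theorem gaussCurv_eq_zero (h : IsHarmonicCubic C) {c : ℝ}
    (hs : IsSemiparallelCubic (gaussCurv c C) C)
    (hscal : cubicNormSq C = Fintype.card ι * (Fintype.card ι - 1) * c) (v w : ι) :
    gaussCurv c C v w = 0 := by
  have hcard : (0 : ℝ) < Fintype.card ι := by exact_mod_cast Fintype.card_pos_iff.2 ⟨v⟩
  refine gaussCurv_eq_zero_of_normSq (le_antisymm ?_ (gaussCurvNormSq_nonneg c C)) v w
  have hsimons := h.simons_identity hs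
  have hgram := cubicNormSq_sq_le_card_mul C
  refine nonpos_of_mul_nonpos_right (a := (Fintype.card ι : ℝ)) ?_ hcard
  rw [h.gaussCurvNormSq_eq]
  linear_combination hgram + Fintype.card ι * hsimons
    - (2 * Fintype.card ι * c + cubicNormSq C) * hscal

end IsHarmonicCubic

end CubicForms

section CurvatureForms

variable {W : Type*} [AddCommGroup W]

/-- The algebraic symmetries of a curvature tensor `R a b c d = ⟨R(a, b) c, d⟩`. Homogeneity plays
no role in the polarization arguments, so only additivity in the first argument is recorded. -/
structure IsCurvatureForm (R : W → W → W → W → ℝ) : Prop where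
  add_left : ∀ a a' b c d, R (a + a') b c d = R a b c d + R a' b c d
  antisymm_left : ∀ a b c d, R a b c d = -R b a c d
  antisymm_right : ∀ a b c d, R a b c d = -R a b d c
  bianchi : ∀ a b c d, R a b c d + R b c a d + R c a b d = 0

namespace IsCurvatureForm

variable {R R' : W → W → W → W → ℝ}

theorem pair_symm (h : IsCurvatureForm R) (a b c d : W) : R a b c d = R c d a b := by
  linarith [h.bianchi a b c d, h.bianchi b c d a, h.bianchi c d a b, h.bianchi d a b c,
    h.antisymm_right b c a d, h.antisymm_right c a b d, h.antisymm_left c a b d,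
    h.antisymm_left c a d b, h.antisymm_right c d b a, h.antisymm_right d b c a,
    h.antisymm_left d b a c, h.antisymm_right d a c b, h.antisymm_right a b d c,
    h.antisymm_left b d c a, h.antisymm_right a c b d, h.antisymm_right b d a c,
    h.antisymm_left b d a c, h.antisymm_right d a b c, h.antisymm_left a c d b]

theorem add_two (h : IsCurvatureForm R) (a b b' c d : W) :
    R a (b + b') c d = R a b c d + R a b' c d := by
  rw [h.antisymm_left, h.add_left, h.antisymm_left b, h.antisymm_left b']
  ring

theorem add_three (h : IsCurvatureForm R) (a b c c' d : W) :
    R a b (c + c') d = R a b c d + R a b c' d := by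
  rw [h.pair_symm, h.add_left, h.pair_symm c, h.pair_symm c']

theorem add_four (h : IsCurvatureForm R) (a b c d d' : W) :
    R a b c (d + d') = R a b c d + R a b c d' := by
  rw [h.pair_symm, h.add_two, h.pair_symm c, h.pair_symm c]

theorem neg_left (h : IsCurvatureForm R) (a b c d : W) : R (-a) b c d = -R a b c d := by
  have hzero := h.add_left 0 0 b c d
  have hneg := h.add_left a (-a) b c d
  simp only [add_zero, add_neg_cancel] at hzero hneg
  linarith

theorem neg_two (h : IsCurvatureForm R) (a b c d : W) : R a (-b) c d = -R a b c d := by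
  rw [h.antisymm_left, h.neg_left, h.antisymm_left b, neg_neg]

theorem neg_three (h : IsCurvatureForm R) (a b c d : W) : R a b (-c) d = -R a b c d := by
  rw [h.pair_symm, h.neg_left, h.pair_symm c]

theorem neg_four (h : IsCurvatureForm R) (a b c d : W) : R a b c (-d) = -R a b c d := by
  rw [h.pair_symm, h.neg_two, h.pair_symm c]

theorem eq_zero_of_sectional (h : IsCurvatureForm R) (h0 : ∀ a b, R a b b a = 0) (a b c d : W) :
    R a b c d = 0 := by
  have hmid : ∀ a b d, R a b b d = 0 := by
    intro a b d
    have hpolar := h0 (a + d) b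
    rw [h.add_left, h.add_four, h.add_four, h0, h0, h.pair_symm d, h.antisymm_left b a,
      h.antisymm_right a b d b] at hpolar
    linarith
  have hswap : ∀ a b c d, R a b c d = -R a c b d := by
    intro a b c d
    have hpolar := hmid a (b + c) d
    rw [h.add_two, h.add_three, h.add_three, hmid, hmid] at hpolar
    linarith
  have hbianchi := h.bianchi a b c d
  rw [hswap b c a d, h.antisymm_left b a, h.antisymm_left c a b d, hswap a c b d] at hbianchi
  linarith

theorem sub (h : IsCurvatureForm R) (h' : IsCurvatureForm R') :
    IsCurvatureForm fun a b c d => R a b c d - R' a b c d where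
  add_left a a' b c d := by rw [h.add_left, h'.add_left]; ring
  antisymm_left a b c d := by rw [h.antisymm_left, h'.antisymm_left]; ring
  antisymm_right a b c d := by rw [h.antisymm_right, h'.antisymm_right]; ring
  bianchi a b c d := by linear_combination h.bianchi a b c d - h'.bianchi a b c d

theorem const_mul (h : IsCurvatureForm R) (r : ℝ) :
    IsCurvatureForm fun a b c d => r * R a b c d where
  add_left a a' b c d := by rw [h.add_left, mul_add]
  antisymm_left a b c d := by rw [h.antisymm_left, mul_neg]
  antisymm_right a b c d := by rw [h.antisymm_right, mul_neg]
  bianchi a b c d := by linear_combination r * h.bianchi a b c d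

section Holomorphic

variable {J : W →+ W}

-- Polarize `R a (J a) (J a) a = 0` along `a ± b`; the Bianchi identity rewrites the mixed terms.
theorem add_three_mul_eq_zero (h : IsCurvatureForm R) (hJ : ∀ a, J (J a) = -a)
    (hR : ∀ a b c d, R a b (J c) (J d) = R a b c d) (h0 : ∀ a, R a (J a) (J a) a = 0) (a b : W) :
    R a b b a + 3 * R a (J b) (J b) a = 0 := by
  have hR' : ∀ a b c d, R (J a) (J b) c d = R a b c d := fun a b c d => by
    rw [h.pair_symm, hR, h.pair_symm]
  have hplus := h0 (a + b)
  have hminus := h0 (a + -b)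
  simp only [map_add, map_neg, h.add_left, h.add_two, h.add_three, h.add_four, h.neg_left,
    h.neg_two, h.neg_three, h.neg_four, h0] at hplus hminus
  have hmixed : R b (J b) (J a) a = R a (J a) (J b) b := by
    rw [h.pair_symm, h.antisymm_left, h.antisymm_right, neg_neg]
  have hsec : R b (J a) (J a) b = R a (J b) (J b) a := by
    rw [← hR', ← hR, hJ, h.neg_two, h.neg_three, neg_neg, h.antisymm_left, h.antisymm_right,
      neg_neg]
  have hskew : R b (J a) (J b) a = R a (J b) (J a) b := by
    rw [h.pair_symm, h.antisymm_left, h.antisymm_right, neg_neg]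
  have htwist : R a (J b) (J a) b = R a (J b) (J b) a := by
    rw [← hR, hJ, h.neg_three, h.antisymm_right, neg_neg]
  have hbianchi := h.bianchi a (J a) (J b) b
  rw [hR', h.antisymm_right a b a b, h.antisymm_left (J b) a, htwist] at hbianchi
  linarith

theorem eq_zero_of_holomorphic (h : IsCurvatureForm R) (hJ : ∀ a, J (J a) = -a)
    (hR : ∀ a b c d, R a b (J c) (J d) = R a b c d) (h0 : ∀ a, R a (J a) (J a) a = 0)
    (a b c d : W) : R a b c d = 0 := by
  refine h.eq_zero_of_sectional (fun a b => ?_) a b c d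
  have hb := h.add_three_mul_eq_zero hJ hR h0 a b
  have hJb := h.add_three_mul_eq_zero hJ hR h0 a (J b)
  rw [hJ, h.neg_two, h.neg_three] at hJb
  linarith

theorem eq_of_holomorphic (h : IsCurvatureForm R) (h' : IsCurvatureForm R')
    (hJ : ∀ a, J (J a) = -a) (hR : ∀ a b c d, R a b (J c) (J d) = R a b c d)
    (hR' : ∀ a b c d, R' a b (J c) (J d) = R' a b c d)
    (hol : ∀ a, R a (J a) (J a) a = R' a (J a) (J a) a) (a b c d : W) :
    R a b c d = R' a b c d :=
  sub_eq_zero.1 <| (h.sub h').eq_zero_of_holomorphic hJ (fun a b c d => by rw [hR, hR'])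
    (fun a => sub_eq_zero.2 (hol a)) a b c d

end Holomorphic

end IsCurvatureForm

section HolomorphicCurv

variable {W : Type*} [NormedAddCommGroup W] [NormedSpace ℝ W]

/-- The curvature tensor of constant holomorphic sectional curvature four for the metric `B` and
the complex structure `J`. -/
def holomorphicCurv (B : W →L[ℝ] W →L[ℝ] ℝ) (J : W →L[ℝ] W) (a b c d : W) : ℝ :=
  B b c * B a d - B a c * B b d + B (J b) c * B (J a) d - B (J a) c * B (J b) d
    + 2 * B a (J b) * B (J c) d

variable {B : W →L[ℝ] W →L[ℝ] ℝ} {J : W →L[ℝ] W}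

theorem isCurvatureForm_holomorphicCurv (hB : ∀ a b, B a b = B b a)
    (hJB : ∀ a b, B (J a) b = -B a (J b)) : IsCurvatureForm (holomorphicCurv B J) where
  add_left a a' b c d := by
    simp only [holomorphicCurv, map_add, add_apply]
    ring
  antisymm_left a b c d := by
    simp only [holomorphicCurv]
    rw [hB a (J b), hJB b a]
    ring
  antisymm_right a b c d := by
    simp only [holomorphicCurv]
    rw [hJB c d, hB c (J d)]
    ring
  bianchi a b c d := by
    simp only [holomorphicCurv]
    rw [hB c a, hB c b, hB b a, hJB a b, hJB c b, hJB c a, hB c (J b), hJB b c, hB c (J a),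
      hJB a c, hB (J b) a]
    ring

theorem holomorphicCurv_map_map (hJ : ∀ a, J (J a) = -a) (hJB : ∀ a b, B (J a) b = -B a (J b))
    (a b c d : W) : holomorphicCurv B J a b (J c) (J d) = holomorphicCurv B J a b c d := by
  simp only [holomorphicCurv, hJB, hJ, map_neg, neg_apply]
  ring

theorem holomorphicCurv_self (hB : ∀ a b, B a b = B b a) (hJ : ∀ a, J (J a) = -a)
    (hJB : ∀ a b, B (J a) b = -B a (J b)) (a : W) :
    holomorphicCurv B J a (J a) (J a) a = 4 * B a a ^ 2 := by
  have hself : B a (J a) = 0 := by linarith [hB a (J a), hJB a a]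
  simp only [holomorphicCurv, hJB, hJ, map_neg, neg_apply, hself]
  ring

end HolomorphicCurv

end CurvatureForms

section Calculus

variable {V : Type*} [NormedAddCommGroup V] [NormedSpace ℝ V]
variable {W : Type*} [NormedAddCommGroup W] [NormedSpace ℝ W]
variable {Z : Type*} [NormedAddCommGroup Z] [NormedSpace ℝ Z] {x : V}

theorem fderiv_clm_apply_const {L : V → W →L[ℝ] Z} (hL : DifferentiableAt ℝ L x) (v : V) (w : W) :
    fderiv ℝ (fun y => L y w) x v = fderiv ℝ L x v w := by
  simp [fderiv_clm_apply hL (differentiableAt_const w)]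

theorem fderiv_clm_apply_const₂ {B : V → W →L[ℝ] W →L[ℝ] Z} (hB : DifferentiableAt ℝ B x) (v : V)
    (w w' : W) : fderiv ℝ (fun y => B y w w') x v = fderiv ℝ B x v w w' := by
  rw [fderiv_clm_apply_const (hB.clm_apply (differentiableAt_const w)), fderiv_clm_apply_const hB]

theorem fderiv_apply_symm {B : V → W →L[ℝ] W →L[ℝ] Z} (hB : DifferentiableAt ℝ B x)
    (hsymm : ∀ᶠ y in 𝓝 x, ∀ w w', B y w w' = B y w' w) (v : V) (w w' : W) :
    fderiv ℝ B x v w w' = fderiv ℝ B x v w' w := by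
  have hww' : (fun y => B y w w') =ᶠ[𝓝 x] fun y => B y w' w := hsymm.mono fun y hy => hy w w'
  rw [← fderiv_clm_apply_const₂ hB, hww'.fderiv_eq, fderiv_clm_apply_const₂ hB]

theorem contDiffAt_fderiv_apply {ξ : V → W} (hξ : ContDiffAt ℝ ∞ ξ x) (v : V) :
    ContDiffAt ℝ ∞ (fun y => fderiv ℝ ξ y v) x :=
  (hξ.fderiv_right (m := ∞) (by simp)).clm_apply contDiffAt_const

theorem differentiableAt_fderiv {ξ : V → W} (hξ : ContDiffAt ℝ ∞ ξ x) :
    DifferentiableAt ℝ (fderiv ℝ ξ) x :=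
  (hξ.fderiv_right (m := ∞) (by simp)).differentiableAt (by simp)

theorem fderiv_fderiv_symm {ξ : V → W} (hξ : ContDiffAt ℝ ∞ ξ x) (v w : V) :
    fderiv ℝ (fderiv ℝ ξ) x v w = fderiv ℝ (fderiv ℝ ξ) x w v :=
  (hξ.isSymmSndFDerivAt (by simpa using ENat.LEInfty.out)).eq v w

end Calculus

section LeviCivita

variable {V : Type*} [NormedAddCommGroup V] [NormedSpace ℝ V]
variable {W : Type*} [NormedAddCommGroup W] [NormedSpace ℝ W]

/-- `g` is a smooth Riemannian metric on the open set `Ω`; off `Ω` its values are arbitrary. -/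
structure IsMetricOn (g : V → V →L[ℝ] V →L[ℝ] ℝ) (Ω : Set V) : Prop where
  isOpen : IsOpen Ω
  contDiffAt : ∀ x ∈ Ω, ContDiffAt ℝ ∞ g x
  symm : ∀ x ∈ Ω, ∀ v w, g x v w = g x w v
  pos : ∀ x ∈ Ω, ∀ v, v ≠ 0 → 0 < g x v v

/-- The Christoffel symbols of `g` as a bilinear map, so that they can be differentiated in `x`. -/
def connForm (g : V → V →L[ℝ] V →L[ℝ] ℝ) (x : V) : V →L[ℝ] V →L[ℝ] V :=
  (ContinuousLinearMap.compL ℝ V (V →L[ℝ] ℝ) V (g x).inverse).comp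
    ((1 / 2 : ℝ) • (fderiv ℝ g x + (fderiv ℝ g x).flip -
      (ContinuousLinearMap.flipₗᵢ ℝ V V ℝ).toContinuousLinearEquiv.toContinuousLinearMap.comp
        (fderiv ℝ g x).flip))

theorem christoffel_eq (g : V → V →L[ℝ] V →L[ℝ] ℝ) (x v w : V) :
    christoffel g x v w = connForm g x v w := rfl

theorem cov_const (g : V → V →L[ℝ] V →L[ℝ] ℝ) (x v z : V) :
    cov g (fun _ => z) x v = connForm g x v z := by
  simp [cov, christoffel_eq]

variable {g : V → V →L[ℝ] V →L[ℝ] ℝ} {Ω : Set V} {x : V}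
variable {G : W → W →L[ℝ] W →L[ℝ] ℝ} {Θ : Set W} {u ξ η : V → W}

theorem covAlong_id (g : V → V →L[ℝ] V →L[ℝ] ℝ) (Y : V → V) (x v : V) :
    covAlong g id Y x v = cov g Y x v := by
  simp [cov, covAlong]

theorem covAlong_congr (h : ξ =ᶠ[𝓝 x] η) (v : V) : covAlong G u ξ x v = covAlong G u η x v := by
  simp [covAlong, h.fderiv_eq, h.eq_of_nhds]

theorem covAlong_add (hξ : DifferentiableAt ℝ ξ x) (hη : DifferentiableAt ℝ η x) (v : V) :
    covAlong G u (fun y => ξ y + η y) x v = covAlong G u ξ x v + covAlong G u η x v := by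
  simp only [covAlong, christoffel_eq, fderiv_fun_add hξ hη, map_add, add_apply]
  abel

theorem covAlong_sub (hξ : DifferentiableAt ℝ ξ x) (hη : DifferentiableAt ℝ η x) (v : V) :
    covAlong G u (fun y => ξ y - η y) x v = covAlong G u ξ x v - covAlong G u η x v := by
  simp only [covAlong, christoffel_eq, fderiv_fun_sub hξ hη, map_sub, sub_apply]
  abel

theorem curv_antisymm (g : V → V →L[ℝ] V →L[ℝ] ℝ) (x v w z : V) :
    curv g x v w z = -curv g x w v z := by
  simp [curv]

namespace IsMetricOn

theorem differentiableAt (hg : IsMetricOn g Ω) (hx : x ∈ Ω) : DifferentiableAt ℝ g x :=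
  (hg.contDiffAt x hx).differentiableAt (by simp)

theorem fderiv_symm (hg : IsMetricOn g Ω) (hx : x ∈ Ω) (v w t : V) :
    fderiv ℝ g x v w t = fderiv ℝ g x v t w :=
  fderiv_apply_symm (hg.differentiableAt hx)
    (Filter.mem_of_superset (hg.isOpen.mem_nhds hx) hg.symm) v w t

end IsMetricOn

variable [FiniteDimensional ℝ V]

theorem isInvertible_of_pos {B : V →L[ℝ] V →L[ℝ] ℝ} (hB : ∀ v, v ≠ 0 → 0 < B v v) :
    B.IsInvertible := by
  have hinj : Function.Injective B := by
    rw [injective_iff_map_eq_zero]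
    intro v hv
    by_contra hv₀
    simpa [hv] using hB v hv₀
  have hrank : Module.finrank ℝ V = Module.finrank ℝ (V →L[ℝ] ℝ) := by
    rw [← (LinearMap.toContinuousLinearMap (𝕜 := ℝ) (E := V) (F' := ℝ)).finrank_eq]
    exact (Subspace.dual_finrank_eq (K := ℝ) (V := V)).symm
  let e : V ≃ₗ[ℝ] (V →L[ℝ] ℝ) :=
    LinearEquiv.ofInjectiveOfFinrankEq (B : V →ₗ[ℝ] (V →L[ℝ] ℝ)) hinj hrank
  exact ⟨e.toContinuousLinearEquiv, by ext v w; rfl⟩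

namespace IsMetricOn

theorem isInvertible (hg : IsMetricOn g Ω) (hx : x ∈ Ω) : (g x).IsInvertible :=
  isInvertible_of_pos (hg.pos x hx)

theorem eq_of_apply_eq (hg : IsMetricOn g Ω) (hx : x ∈ Ω) {a b : V}
    (h : ∀ t, g x a t = g x b t) : a = b :=
  (hg.isInvertible hx).injective (ContinuousLinearMap.ext h)

theorem contDiffAt_inverse (hg : IsMetricOn g Ω) (hx : x ∈ Ω) :
    ContDiffAt ℝ ∞ (fun y => (g y).inverse) x :=
  ((hg.isInvertible hx).contDiffAt_map_inverse).comp x (hg.contDiffAt x hx)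

set_option synthInstance.maxHeartbeats 40000 in
-- the group structure on `V →L[ℝ] V →L[ℝ] ℝ` is slow to find under the raised pending depth
theorem contDiffAt_connForm (hg : IsMetricOn g Ω) (hx : x ∈ Ω) :
    ContDiffAt ℝ ∞ (connForm g) x := by
  have hdg : ContDiffAt ℝ ∞ (fderiv ℝ g) x := (hg.contDiffAt x hx).fderiv_right (by simp)
  have hflip : ContDiffAt ℝ ∞ (fun y => (fderiv ℝ g y).flip) x :=
    (ContinuousLinearMap.flipₗᵢ ℝ V V (V →L[ℝ] ℝ)).contDiff.contDiffAt.comp x hdg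
  unfold connForm
  refine ContDiffAt.clm_comp ?_ ?_
  · exact (ContinuousLinearMap.contDiff _).contDiffAt.comp x (hg.contDiffAt_inverse hx)
  · exact ((hdg.add hflip).sub (contDiffAt_const.clm_comp hflip)).const_smul _

theorem differentiableAt_connForm (hg : IsMetricOn g Ω) (hx : x ∈ Ω) :
    DifferentiableAt ℝ (connForm g) x :=
  (hg.contDiffAt_connForm hx).differentiableAt (by simp)

theorem apply_connForm (hg : IsMetricOn g Ω) (hx : x ∈ Ω) (v w t : V) :
    g x (connForm g x v w) t =
      (fderiv ℝ g x v w t + fderiv ℝ g x w v t - fderiv ℝ g x t v w) / 2 := by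
  rw [← christoffel_eq, christoffel, (hg.isInvertible hx).self_apply_inverse]
  simp only [one_div, smul_apply, sub_apply, add_apply, ContinuousLinearMap.flip_apply, smul_eq_mul]
  ring

theorem connForm_symm (hg : IsMetricOn g Ω) (hx : x ∈ Ω) (v w : V) :
    connForm g x v w = connForm g x w v := by
  refine hg.eq_of_apply_eq hx fun t => ?_
  rw [hg.apply_connForm hx, hg.apply_connForm hx, hg.fderiv_symm hx t v w]
  ring

theorem fderiv_connForm_symm (hg : IsMetricOn g Ω) (hx : x ∈ Ω) (v w t : V) :
    fderiv ℝ (connForm g) x v w t = fderiv ℝ (connForm g) x v t w :=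
  fderiv_apply_symm (hg.differentiableAt_connForm hx)
    (Filter.mem_of_superset (hg.isOpen.mem_nhds hx) fun _ hy => hg.connForm_symm hy) v w t

theorem fderiv_apply (hg : IsMetricOn g Ω) (hx : x ∈ Ω) (v a b : V) :
    fderiv ℝ g x v a b = g x (connForm g x v a) b + g x a (connForm g x v b) := by
  rw [hg.symm x hx a, hg.apply_connForm hx, hg.apply_connForm hx, hg.fderiv_symm hx a v b,
    hg.fderiv_symm hx b v a, hg.fderiv_symm hx v b a]
  ring

theorem curv_eq (hg : IsMetricOn g Ω) (hx : x ∈ Ω) (v w z : V) :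
    curv g x v w z =
      fderiv ℝ (connForm g) x v w z - fderiv ℝ (connForm g) x w v z
      + connForm g x v (connForm g x w z) - connForm g x w (connForm g x v z) := by
  have hcov : ∀ v w, cov g (fun y => cov g (fun _ => z) y w) x v =
      fderiv ℝ (connForm g) x v w z + connForm g x v (connForm g x w z) := fun v w => by
    rw [cov, christoffel_eq, cov_const]
    simp only [cov_const]
    rw [fderiv_clm_apply_const₂ (hg.differentiableAt_connForm hx)]
  rw [curv, hcov, hcov]
  abel

theorem curv_bianchi (hg : IsMetricOn g Ω) (hx : x ∈ Ω) (v w z : V) :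
    curv g x v w z + curv g x w z v + curv g x z v w = 0 := by
  rw [hg.curv_eq hx, hg.curv_eq hx, hg.curv_eq hx, hg.fderiv_connForm_symm hx v w z,
    hg.fderiv_connForm_symm hx w z v, hg.fderiv_connForm_symm hx z v w,
    hg.connForm_symm hx z v, hg.connForm_symm hx w v, hg.connForm_symm hx z w]
  abel

end IsMetricOn

end LeviCivita

section LeviCivitaAlong

variable {V : Type*} [NormedAddCommGroup V] [NormedSpace ℝ V]
variable {W : Type*} [NormedAddCommGroup W] [NormedSpace ℝ W] [FiniteDimensional ℝ W]
variable {G : W → W →L[ℝ] W →L[ℝ] ℝ} {Θ : Set W} {u ξ η : V → W} {x : V}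

namespace IsMetricOn

theorem contDiffAt_covAlong (hG : IsMetricOn G Θ) (hu : ContDiffAt ℝ ∞ u x) (hx : u x ∈ Θ)
    (hξ : ContDiffAt ℝ ∞ ξ x) (v : V) : ContDiffAt ℝ ∞ (fun y => covAlong G u ξ y v) x := by
  simp only [covAlong, christoffel_eq]
  exact (contDiffAt_fderiv_apply hξ v).add
    ((((hG.contDiffAt_connForm hx).comp x hu).clm_apply
      (contDiffAt_fderiv_apply hu v)).clm_apply hξ)

theorem fderiv_inner (hG : IsMetricOn G Θ) (hu : DifferentiableAt ℝ u x) (hx : u x ∈ Θ)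
    (hξ : DifferentiableAt ℝ ξ x) (hη : DifferentiableAt ℝ η x) (v : V) :
    fderiv ℝ (fun y => G (u y) (ξ y) (η y)) x v =
      G (u x) (covAlong G u ξ x v) (η x) + G (u x) (ξ x) (covAlong G u η x v) := by
  have hleibniz := ((((hG.differentiableAt hx).hasFDerivAt.comp x hu.hasFDerivAt).clm_apply
    hξ.hasFDerivAt).clm_apply hη.hasFDerivAt).fderiv
  simp only [Function.comp_apply] at hleibniz
  rw [hleibniz]
  simp only [ContinuousLinearMap.flip_add, add_apply, ContinuousLinearMap.comp_apply,
    ContinuousLinearMap.flip_apply, hG.fderiv_apply hx, covAlong, christoffel_eq, map_add]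
  ring

theorem fderiv_covAlong (hG : IsMetricOn G Θ) (hu : ContDiffAt ℝ ∞ u x) (hx : u x ∈ Θ)
    (hξ : ContDiffAt ℝ ∞ ξ x) (v w : V) :
    fderiv ℝ (fun y => covAlong G u ξ y w) x v =
      fderiv ℝ (fderiv ℝ ξ) x v w
      + (fderiv ℝ (connForm G) (u x) (fderiv ℝ u x v) (fderiv ℝ u x w) (ξ x)
      + connForm G (u x) (fderiv ℝ (fderiv ℝ u) x v w) (ξ x)
      + connForm G (u x) (fderiv ℝ u x w) (fderiv ℝ ξ x v)) := by
  have hud : DifferentiableAt ℝ u x := hu.differentiableAt (by simp)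
  have hξd : DifferentiableAt ℝ ξ x := hξ.differentiableAt (by simp)
  have hduw : DifferentiableAt ℝ (fun y => fderiv ℝ u y w) x :=
    (differentiableAt_fderiv hu).clm_apply (differentiableAt_const w)
  have hdξw : DifferentiableAt ℝ (fun y => fderiv ℝ ξ y w) x :=
    (differentiableAt_fderiv hξ).clm_apply (differentiableAt_const w)
  have hΓu : DifferentiableAt ℝ (fun y => connForm G (u y)) x :=
    (hG.differentiableAt_connForm hx).comp x hud
  have hΓ' : fderiv ℝ (fun y => connForm G (u y)) x =
      (fderiv ℝ (connForm G) (u x)).comp (fderiv ℝ u x) :=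
    fderiv_comp x (hG.differentiableAt_connForm hx) hud
  simp only [covAlong, christoffel_eq]
  rw [fderiv_fun_add hdξw ((hΓu.clm_apply hduw).clm_apply hξd),
    fderiv_clm_apply (hΓu.clm_apply hduw) hξd, fderiv_clm_apply hΓu hduw, hΓ']
  simp only [ContinuousLinearMap.flip_add, add_apply, ContinuousLinearMap.comp_apply,
    ContinuousLinearMap.flip_apply, fderiv_clm_apply_const (differentiableAt_fderiv hu),
    fderiv_clm_apply_const (differentiableAt_fderiv hξ), add_right_inj]
  abel

theorem covAlong_comm (hG : IsMetricOn G Θ) (hu : ContDiffAt ℝ ∞ u x) (hx : u x ∈ Θ)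
    (hξ : ContDiffAt ℝ ∞ ξ x) (v w : V) :
    covAlong G u (fun y => covAlong G u ξ y w) x v - covAlong G u (fun y => covAlong G u ξ y v) x w
      = curv G (u x) (fderiv ℝ u x v) (fderiv ℝ u x w) (ξ x) := by
  have hcov : ∀ v w, covAlong G u (fun y => covAlong G u ξ y w) x v =
    fderiv ℝ (fun y => covAlong G u ξ y w) x v
      + connForm G (u x) (fderiv ℝ u x v) (covAlong G u ξ x w) := fun _ _ => rfl
  rw [hG.curv_eq hx, hcov, hcov, hG.fderiv_covAlong hu hx hξ, hG.fderiv_covAlong hu hx hξ,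
    fderiv_fderiv_symm hξ v w, fderiv_fderiv_symm hu v w]
  simp only [covAlong, christoffel_eq, map_add]
  abel

theorem fderiv_fderiv_apply (hG : IsMetricOn G Θ) {y : W} (hy : y ∈ Θ) (a b c d : W) :
    fderiv ℝ (fderiv ℝ (fun y => G y c d)) y a b =
      G y (cov G (fun y => cov G (fun _ => c) y b) y a) d
      + G y (cov G (fun _ => c) y b) (cov G (fun _ => d) y a)
      + (G y (cov G (fun _ => c) y a) (cov G (fun _ => d) y b)
      + G y c (cov G (fun y => cov G (fun _ => d) y b) y a)) := by
  have hGcd : ContDiffAt ℝ ∞ (fun y => G y c d) y :=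
    ((hG.contDiffAt y hy).clm_apply contDiffAt_const).clm_apply contDiffAt_const
  have hcov : ∀ c, DifferentiableAt ℝ (fun y => cov G (fun _ => c) y b) y := fun c => by
    simp only [cov_const]
    exact ((hG.differentiableAt_connForm hy).clm_apply (differentiableAt_const b)).clm_apply
      (differentiableAt_const c)
  have hfirst : (fun y => fderiv ℝ (fun y => G y c d) y b) =ᶠ[𝓝 y] fun y =>
      G y (cov G (fun _ => c) y b) d + G y c (cov G (fun _ => d) y b) := by
    filter_upwards [hG.isOpen.mem_nhds hy] with y hy
    rw [fderiv_clm_apply_const₂ (hG.differentiableAt hy), hG.fderiv_apply hy, cov_const, cov_const]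
  have hinner {Y Y' : W → W} (hY : DifferentiableAt ℝ Y y) (hY' : DifferentiableAt ℝ Y' y) :
      fderiv ℝ (fun y => G y (Y y) (Y' y)) y a =
        G y (cov G Y y a) (Y' y) + G y (Y y) (cov G Y' y a) := by
    simpa only [covAlong_id, id] using hG.fderiv_inner (u := id) differentiableAt_id hy hY hY' a
  rw [← fderiv_clm_apply_const (differentiableAt_fderiv hGcd), hfirst.fderiv_eq, fderiv_fun_add
    (((hG.differentiableAt hy).clm_apply (hcov c)).clm_apply (differentiableAt_const d))
    (((hG.differentiableAt hy).clm_apply (differentiableAt_const c)).clm_apply (hcov d)),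
    add_apply, hinner (hcov c) (differentiableAt_const d),
    hinner (differentiableAt_const c) (hcov d)]

theorem curv_skew (hG : IsMetricOn G Θ) {y : W} (hy : y ∈ Θ) (a b c d : W) :
    G y (curv G y a b c) d = -G y (curv G y a b d) c := by
  have hGcd : ContDiffAt ℝ ∞ (fun y => G y c d) y :=
    ((hG.contDiffAt y hy).clm_apply contDiffAt_const).clm_apply contDiffAt_const
  have hcomm := fderiv_fderiv_symm hGcd a b
  rw [hG.fderiv_fderiv_apply hy, hG.fderiv_fderiv_apply hy] at hcomm
  rw [hG.symm y hy _ c]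
  simp only [curv, map_sub, sub_apply]
  linear_combination hcomm

end IsMetricOn

end LeviCivitaAlong

section Immersions

variable {V : Type*} [NormedAddCommGroup V] [NormedSpace ℝ V]
variable {W : Type*} [NormedAddCommGroup W] [NormedSpace ℝ W]
variable {G : W → W →L[ℝ] W →L[ℝ] ℝ} {Θ : Set W} {u ξ : V → W} {U : Set V} {x : V}

/-- `u` is a smooth immersion of the open set `U` into `Θ`. -/
structure IsImmersionInto (u : V → W) (U : Set V) (Θ : Set W) : Prop where
  isOpen : IsOpen U
  contDiffAt : ∀ x ∈ U, ContDiffAt ℝ ∞ u x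
  mapsTo : ∀ x ∈ U, u x ∈ Θ
  injective : ∀ x ∈ U, Function.Injective (fderiv ℝ u x)

namespace IsImmersionInto

theorem differentiableAt (hu : IsImmersionInto u U Θ) (hx : x ∈ U) : DifferentiableAt ℝ u x :=
  (hu.contDiffAt x hx).differentiableAt (by simp)

theorem contDiffAt_fderiv (hu : IsImmersionInto u U Θ) (hx : x ∈ U) :
    ContDiffAt ℝ ∞ (fderiv ℝ u) x :=
  (hu.contDiffAt x hx).fderiv_right (by simp)

theorem differentiableAt_pushforward (hu : IsImmersionInto u U Θ) (hx : x ∈ U) {Y : V → V}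
    (hY : DifferentiableAt ℝ Y x) : DifferentiableAt ℝ (fun y => fderiv ℝ u y (Y y)) x :=
  (differentiableAt_fderiv (hu.contDiffAt x hx)).clm_apply hY

end IsImmersionInto

theorem inducedMetric_apply (G : W → W →L[ℝ] W →L[ℝ] ℝ) (u : V → W) (x v w : V) :
    inducedMetric G u x v w = G (u x) (fderiv ℝ u x v) (fderiv ℝ u x w) := rfl

theorem contDiffAt_bilinearComp {X : Type*} [NormedAddCommGroup X] [NormedSpace ℝ X]
    {B : X → W →L[ℝ] W →L[ℝ] ℝ} {L : X → V →L[ℝ] W} {x : X} (hB : ContDiffAt ℝ ∞ B x)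
    (hL : ContDiffAt ℝ ∞ L x) : ContDiffAt ℝ ∞ (fun y => (B y).bilinearComp (L y) (L y)) x := by
  have hBL : ContDiffAt ℝ ∞ (fun y => ((B y).comp (L y)).flip) x :=
    (ContinuousLinearMap.flipₗᵢ ℝ V W ℝ).contDiff.contDiffAt.comp x (hB.clm_comp hL)
  exact (ContinuousLinearMap.flipₗᵢ ℝ V V ℝ).contDiff.contDiffAt.comp x (hBL.clm_comp hL)

theorem IsMetricOn.induced (hG : IsMetricOn G Θ) (hu : IsImmersionInto u U Θ) :
    IsMetricOn (inducedMetric G u) U where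
  isOpen := hu.isOpen
  contDiffAt x hx := contDiffAt_bilinearComp
    ((hG.contDiffAt _ (hu.mapsTo x hx)).comp x (hu.contDiffAt x hx)) (hu.contDiffAt_fderiv hx)
  symm x hx _ _ := hG.symm _ (hu.mapsTo x hx) _ _
  pos x hx _ hv := hG.pos _ (hu.mapsTo x hx) _ fun hduv =>
    hv (hu.injective x hx (hduv.trans (map_zero _).symm))

theorem isLinearMap_tangentialPart (G : W → W →L[ℝ] W →L[ℝ] ℝ) (u : V → W) (x : V) :
    IsLinearMap ℝ (tangentialPart G u x) where
  map_add a b := by simp [tangentialPart, ContinuousLinearMap.add_comp]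
  map_smul r a := by simp [tangentialPart, ContinuousLinearMap.smul_comp]

theorem isLinearMap_normalPart (G : W → W →L[ℝ] W →L[ℝ] ℝ) (u : V → W) (x : V) :
    IsLinearMap ℝ (normalPart G u x) where
  map_add a b := by
    simp only [normalPart, (isLinearMap_tangentialPart G u x).map_add, map_add]
    abel
  map_smul r a := by
    simp only [normalPart, (isLinearMap_tangentialPart G u x).map_smul, map_smul, smul_sub]

theorem fderiv_tangentialPart_add_normalPart (G : W → W →L[ℝ] W →L[ℝ] ℝ) (u : V → W) (x : V)
    (a : W) : fderiv ℝ u x (tangentialPart G u x a) + normalPart G u x a = a := by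
  simp [normalPart]

theorem sff_eq (G : W → W →L[ℝ] W →L[ℝ] ℝ) (hu : ContDiffAt ℝ ∞ u x) (v w : V) :
    sff G u x v w = normalPart G u x (fderiv ℝ (fderiv ℝ u) x v w
      + connForm G (u x) (fderiv ℝ u x v) (fderiv ℝ u x w)) := by
  rw [sff, covAlong, fderiv_clm_apply_const (differentiableAt_fderiv hu), christoffel_eq]

theorem isLinearMap_sff_left (G : W → W →L[ℝ] W →L[ℝ] ℝ) (hu : ContDiffAt ℝ ∞ u x) (w : V) :
    IsLinearMap ℝ fun v => sff G u x v w where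
  map_add a b := by
    simp only [sff_eq G hu, map_add, add_apply, ← (isLinearMap_normalPart G u x).map_add,
      add_add_add_comm]
  map_smul r a := by
    simp only [sff_eq G hu, map_smul, smul_apply, ← smul_add,
      (isLinearMap_normalPart G u x).map_smul]

theorem isLinearMap_sff_right (G : W → W →L[ℝ] W →L[ℝ] ℝ) (hu : ContDiffAt ℝ ∞ u x) (v : V) :
    IsLinearMap ℝ (sff G u x v) where
  map_add a b := by
    simp only [sff_eq G hu, map_add, ← (isLinearMap_normalPart G u x).map_add, add_add_add_comm]
  map_smul r a := by
    simp only [sff_eq G hu, map_smul, ← smul_add, (isLinearMap_normalPart G u x).map_smul]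

namespace IsMetricOn

theorem inner_normalPart_of_normal (hG : IsMetricOn G Θ) (hu : IsImmersionInto u U Θ) (hx : x ∈ U)
    {a b : W} (h : ∀ s, G (u x) b (fderiv ℝ u x s) = 0) :
    G (u x) (normalPart G u x a) b = G (u x) a b := by
  rw [normalPart, map_sub, sub_apply, hG.symm _ (hu.mapsTo x hx) (fderiv ℝ u x _) b, h, sub_zero]

variable [FiniteDimensional ℝ V]

theorem inner_tangentialPart (hG : IsMetricOn G Θ) (hu : IsImmersionInto u U Θ) (hx : x ∈ U)
    (a : W) (s : V) :
    inducedMetric G u x (tangentialPart G u x a) s = G (u x) a (fderiv ℝ u x s) := by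
  rw [tangentialPart, ((hG.induced hu).isInvertible hx).self_apply_inverse]
  rfl

theorem tangentialPart_eq (hG : IsMetricOn G Θ) (hu : IsImmersionInto u U Θ) (hx : x ∈ U)
    {a : W} {v : V} (h : ∀ s, inducedMetric G u x v s = G (u x) a (fderiv ℝ u x s)) :
    tangentialPart G u x a = v :=
  (hG.induced hu).eq_of_apply_eq hx fun s => by rw [hG.inner_tangentialPart hu hx, h]

theorem tangentialPart_fderiv (hG : IsMetricOn G Θ) (hu : IsImmersionInto u U Θ) (hx : x ∈ U)
    (v : V) : tangentialPart G u x (fderiv ℝ u x v) = v :=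
  hG.tangentialPart_eq hu hx fun _ => rfl

theorem inner_normalPart (hG : IsMetricOn G Θ) (hu : IsImmersionInto u U Θ) (hx : x ∈ U)
    (a : W) (s : V) : G (u x) (normalPart G u x a) (fderiv ℝ u x s) = 0 := by
  rw [normalPart, map_sub, sub_apply, ← inducedMetric_apply,
    hG.inner_tangentialPart hu hx, sub_self]

theorem inner_sff (hG : IsMetricOn G Θ) (hu : IsImmersionInto u U Θ) (hx : x ∈ U)
    (v w s : V) : G (u x) (sff G u x v w) (fderiv ℝ u x s) = 0 :=
  hG.inner_normalPart hu hx _ _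

theorem normalPart_fderiv (hG : IsMetricOn G Θ) (hu : IsImmersionInto u U Θ) (hx : x ∈ U)
    (v : V) : normalPart G u x (fderiv ℝ u x v) = 0 := by
  rw [normalPart, hG.tangentialPart_fderiv hu hx, sub_self]

theorem normalPart_of_normal (hG : IsMetricOn G Θ) (hu : IsImmersionInto u U Θ) (hx : x ∈ U)
    {a : W} (h : ∀ s, G (u x) a (fderiv ℝ u x s) = 0) : normalPart G u x a = a := by
  rw [normalPart, hG.tangentialPart_eq hu hx (v := 0) (by simp [h]), map_zero, sub_zero]

theorem contDiffAt_tangentialPart (hG : IsMetricOn G Θ) (hu : IsImmersionInto u U Θ) (hx : x ∈ U)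
    (hξ : ContDiffAt ℝ ∞ ξ x) : ContDiffAt ℝ ∞ (fun y => tangentialPart G u y (ξ y)) x :=
  ((hG.induced hu).contDiffAt_inverse hx).clm_apply
    ((((hG.contDiffAt _ (hu.mapsTo x hx)).comp x (hu.contDiffAt x hx)).clm_apply hξ).clm_comp
      (hu.contDiffAt_fderiv hx))

theorem isNormalFieldAt_normalPart (hG : IsMetricOn G Θ) (hu : IsImmersionInto u U Θ) (hx : x ∈ U)
    (hξ : ContDiffAt ℝ ∞ ξ x) : IsNormalFieldAt G u (fun y => normalPart G u y (ξ y)) x := by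
  refine ⟨hξ.sub ((hu.contDiffAt_fderiv hx).clm_apply (hG.contDiffAt_tangentialPart hu hx hξ)), ?_⟩
  filter_upwards [hu.isOpen.mem_nhds hx] with y hy v using hG.inner_normalPart hu hy _ _

end IsMetricOn

end Immersions

section SubmanifoldEquations

variable {V : Type*} [NormedAddCommGroup V] [NormedSpace ℝ V]
variable {W : Type*} [NormedAddCommGroup W] [NormedSpace ℝ W] [FiniteDimensional ℝ W]
variable {G : W → W →L[ℝ] W →L[ℝ] ℝ} {Θ : Set W} {u ξ : V → W} {U : Set V} {x : V}

namespace IsMetricOn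

theorem covAlong_fderiv_symm (hG : IsMetricOn G Θ) (hu : ContDiffAt ℝ ∞ u x) (hx : u x ∈ Θ)
    (v w : V) :
    covAlong G u (fun y => fderiv ℝ u y w) x v = covAlong G u (fun y => fderiv ℝ u y v) x w := by
  simp only [covAlong, christoffel_eq, fderiv_clm_apply_const (differentiableAt_fderiv hu)]
  rw [fderiv_fderiv_symm hu, hG.connForm_symm hx]

theorem sff_symm (hG : IsMetricOn G Θ) (hu : IsImmersionInto u U Θ) (hx : x ∈ U)
    (v w : V) : sff G u x v w = sff G u x w v := by
  rw [sff, hG.covAlong_fderiv_symm (hu.contDiffAt x hx) (hu.mapsTo x hx), sff]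

theorem fderiv_inducedMetric (hG : IsMetricOn G Θ) (hu : IsImmersionInto u U Θ) (hx : x ∈ U)
    (v w t : V) : fderiv ℝ (inducedMetric G u) x v w t =
      G (u x) (covAlong G u (fun y => fderiv ℝ u y w) x v) (fderiv ℝ u x t)
      + G (u x) (covAlong G u (fun y => fderiv ℝ u y t) x v) (fderiv ℝ u x w) := by
  have hdu : ∀ w, DifferentiableAt ℝ (fun y => fderiv ℝ u y w) x := fun w =>
    hu.differentiableAt_pushforward hx (differentiableAt_const w)
  rw [← fderiv_clm_apply_const₂ ((hG.induced hu).differentiableAt hx)]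
  simp only [inducedMetric_apply]
  rw [hG.fderiv_inner (hu.differentiableAt hx) (hu.mapsTo x hx) (hdu w) (hdu t),
    hG.symm _ (hu.mapsTo x hx) (fderiv ℝ u x w)]

variable [FiniteDimensional ℝ V]

theorem isNormalFieldAt_sff (hG : IsMetricOn G Θ) (hu : IsImmersionInto u U Θ) (hx : x ∈ U)
    (z t : V) : IsNormalFieldAt G u (fun y => sff G u y z t) x :=
  hG.isNormalFieldAt_normalPart hu hx (hG.contDiffAt_covAlong (hu.contDiffAt x hx)
    (hu.mapsTo x hx) (contDiffAt_fderiv_apply (hu.contDiffAt x hx) t) z)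

theorem tangentialPart_covAlong_fderiv_const (hG : IsMetricOn G Θ) (hu : IsImmersionInto u U Θ)
    (hx : x ∈ U) (v w : V) :
    tangentialPart G u x (covAlong G u (fun y => fderiv ℝ u y w) x v) =
      connForm (inducedMetric G u) x v w := by
  have hsymm := hG.covAlong_fderiv_symm (hu.contDiffAt x hx) (hu.mapsTo x hx)
  refine hG.tangentialPart_eq hu hx fun s => ?_
  rw [(hG.induced hu).apply_connForm hx, hG.fderiv_inducedMetric hu hx,
    hG.fderiv_inducedMetric hu hx, hG.fderiv_inducedMetric hu hx, hsymm w v, hsymm w s, hsymm s v]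
  ring

theorem covAlong_fderiv_const (hG : IsMetricOn G Θ) (hu : IsImmersionInto u U Θ) (hx : x ∈ U)
    (v w : V) :
    covAlong G u (fun y => fderiv ℝ u y w) x v =
      fderiv ℝ u x (connForm (inducedMetric G u) x v w) + sff G u x v w := by
  rw [← hG.tangentialPart_covAlong_fderiv_const hu hx]
  exact (fderiv_tangentialPart_add_normalPart _ _ _ _).symm

theorem gauss_formula (hG : IsMetricOn G Θ) (hu : IsImmersionInto u U Θ) (hx : x ∈ U)
    {Y : V → V} (hY : DifferentiableAt ℝ Y x) (v : V) :
    covAlong G u (fun y => fderiv ℝ u y (Y y)) x v =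
      fderiv ℝ u x (cov (inducedMetric G u) Y x v) + sff G u x v (Y x) := by
  have hdu : DifferentiableAt ℝ (fderiv ℝ u) x := differentiableAt_fderiv (hu.contDiffAt x hx)
  have hleibniz : covAlong G u (fun y => fderiv ℝ u y (Y y)) x v =
      fderiv ℝ u x (fderiv ℝ Y x v) + covAlong G u (fun y => fderiv ℝ u y (Y x)) x v := by
    simp only [covAlong, fderiv_clm_apply hdu hY, fderiv_clm_apply_const hdu, add_apply,
      ContinuousLinearMap.comp_apply, ContinuousLinearMap.flip_apply]
    abel
  rw [hleibniz, hG.covAlong_fderiv_const hu hx, cov, christoffel_eq, map_add]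
  abel

theorem normalCov_fderiv (hG : IsMetricOn G Θ) (hu : IsImmersionInto u U Θ) (hx : x ∈ U)
    {Y : V → V} (hY : DifferentiableAt ℝ Y x) (v : V) :
    normalCov G u (fun y => fderiv ℝ u y (Y y)) x v = sff G u x v (Y x) := by
  rw [normalCov, hG.gauss_formula hu hx hY, (isLinearMap_normalPart G u x).map_add,
    hG.normalPart_fderiv hu hx, zero_add, hG.normalPart_of_normal hu hx (hG.inner_sff hu hx _ _)]

theorem normalCov_normalPart (hG : IsMetricOn G Θ) (hu : IsImmersionInto u U Θ) (hx : x ∈ U)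
    (hξ : ContDiffAt ℝ ∞ ξ x) (v : V) :
    normalCov G u (fun y => normalPart G u y (ξ y)) x v =
      normalCov G u ξ x v - sff G u x v (tangentialPart G u x (ξ x)) := by
  have hT : DifferentiableAt ℝ (fun y => tangentialPart G u y (ξ y)) x :=
    (hG.contDiffAt_tangentialPart hu hx hξ).differentiableAt (by simp)
  rw [← hG.normalCov_fderiv hu hx hT]
  simp only [normalPart, normalCov]
  rw [covAlong_sub (hξ.differentiableAt (by simp)) (hu.differentiableAt_pushforward hx hT)]
  exact (isLinearMap_normalPart G u x).map_sub _ _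

theorem weingarten_formula (hG : IsMetricOn G Θ) (hu : IsImmersionInto u U Θ) (hx : x ∈ U)
    (hξ : IsNormalFieldAt G u ξ x) (v s : V) :
    G (u x) (covAlong G u ξ x v) (fderiv ℝ u x s) = -G (u x) (ξ x) (sff G u x v s) := by
  have hinner := hG.fderiv_inner (hu.differentiableAt hx) (hu.mapsTo x hx)
    (hξ.1.differentiableAt (by simp))
    (hu.differentiableAt_pushforward hx (differentiableAt_const s)) v
  have hnormal : (fun y => G (u y) (ξ y) (fderiv ℝ u y s)) =ᶠ[𝓝 x] fun _ => 0 :=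
    hξ.2.mono fun y hy => hy s
  rw [hnormal.fderiv_eq, fderiv_fun_const, hG.covAlong_fderiv_const hu hx, map_add,
    hξ.2.self_of_nhds, zero_add] at hinner
  exact eq_neg_of_add_eq_zero_left hinner.symm

theorem inner_covAlong_covAlong (hG : IsMetricOn G Θ) (hu : IsImmersionInto u U Θ) (hx : x ∈ U)
    (v w z t : V) :
    G (u x) (covAlong G u (fun y => covAlong G u (fun y => fderiv ℝ u y z) y w) x v)
        (fderiv ℝ u x t) =
      inducedMetric G u x (cov (inducedMetric G u)
        (fun y => cov (inducedMetric G u) (fun _ => z) y w) x v) t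
      - G (u x) (sff G u x w z) (sff G u x v t) := by
  have hcov : DifferentiableAt ℝ
      (fun y => cov (inducedMetric G u) (fun _ => z) y w) x := by
    simp only [cov_const]
    exact (((hG.induced hu).differentiableAt_connForm hx).clm_apply
      (differentiableAt_const w)).clm_apply (differentiableAt_const z)
  have hσ := hG.isNormalFieldAt_sff hu hx w z
  have hgauss : (fun y => covAlong G u (fun y => fderiv ℝ u y z) y w) =ᶠ[𝓝 x] fun y =>
      fderiv ℝ u y (cov (inducedMetric G u) (fun _ => z) y w) + sff G u y w z := by
    filter_upwards [hu.isOpen.mem_nhds hx] with y hy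
    rw [hG.covAlong_fderiv_const hu hy, cov_const]
  rw [covAlong_congr hgauss, covAlong_add (hu.differentiableAt_pushforward hx hcov)
    (hσ.1.differentiableAt (by simp)), hG.gauss_formula hu hx hcov, map_add, map_add, add_apply,
    add_apply, hG.inner_sff hu hx, hG.weingarten_formula hu hx hσ, ← inducedMetric_apply,
    add_zero, sub_eq_add_neg]

theorem gauss_equation (hG : IsMetricOn G Θ) (hu : IsImmersionInto u U Θ) (hx : x ∈ U)
    (v w z t : V) :
    inducedMetric G u x (curv (inducedMetric G u) x v w z) t =
      G (u x) (curv G (u x) (fderiv ℝ u x v) (fderiv ℝ u x w) (fderiv ℝ u x z)) (fderiv ℝ u x t)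
      + G (u x) (sff G u x w z) (sff G u x v t) - G (u x) (sff G u x v z) (sff G u x w t) := by
  rw [← hG.covAlong_comm (hu.contDiffAt x hx) (hu.mapsTo x hx)
    (contDiffAt_fderiv_apply (hu.contDiffAt x hx) z), map_sub, sub_apply,
    hG.inner_covAlong_covAlong hu hx, hG.inner_covAlong_covAlong hu hx, curv, map_sub, sub_apply]
  ring

theorem ricci_equation (hG : IsMetricOn G Θ) (hu : IsImmersionInto u U Θ) (hx : x ∈ U)
    (hξ : ContDiffAt ℝ ∞ ξ x) (v w : V) :
    normalCurv G u ξ x v w =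
      normalPart G u x (curv G (u x) (fderiv ℝ u x v) (fderiv ℝ u x w) (ξ x))
      - sff G u x v (tangentialPart G u x (covAlong G u ξ x w))
      + sff G u x w (tangentialPart G u x (covAlong G u ξ x v)) := by
  have hcov := hG.contDiffAt_covAlong (hu.contDiffAt x hx) (hu.mapsTo x hx) hξ
  have hD : ∀ v w, normalCov G u (fun y => normalCov G u ξ y w) x v =
      normalPart G u x (covAlong G u (fun y => covAlong G u ξ y w) x v)
      - sff G u x v (tangentialPart G u x (covAlong G u ξ x w)) := fun v w =>
    hG.normalCov_normalPart hu hx (hcov w) v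
  rw [normalCurv, hD, hD, ← hG.covAlong_comm (hu.contDiffAt x hx) (hu.mapsTo x hx) hξ,
    (isLinearMap_normalPart G u x).map_sub]
  abel

end IsMetricOn

end SubmanifoldEquations

section Kahler

variable {V : Type*} [NormedAddCommGroup V] [NormedSpace ℝ V]
variable {W : Type*} [NormedAddCommGroup W] [NormedSpace ℝ W]
variable {G : W → W →L[ℝ] W →L[ℝ] ℝ} {J : W → W →L[ℝ] W} {Θ : Set W} {y : W}

theorem covAlong_parallel {u ξ : V → W} {x : V} (hJ : DifferentiableAt ℝ J (u x))
    (hu : DifferentiableAt ℝ u x) (hξ : DifferentiableAt ℝ ξ x)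
    (hpar : ∀ v w, cov G (fun y => J y w) (u x) v = J (u x) (cov G (fun _ => w) (u x) v)) (v : V) :
    covAlong G u (fun y => J (u y) (ξ y)) x v = J (u x) (covAlong G u ξ x v) := by
  have hJu : fderiv ℝ (fun y => J (u y)) x = (fderiv ℝ J (u x)).comp (fderiv ℝ u x) :=
    fderiv_comp x hJ hu
  have hparξ := hpar (fderiv ℝ u x v) (ξ x)
  rw [cov, fderiv_clm_apply_const hJ, cov_const, christoffel_eq] at hparξ
  have hJud : DifferentiableAt ℝ (fun y => J (u y)) x := hJ.comp x hu
  rw [covAlong, fderiv_clm_apply hJud hξ, hJu, covAlong, christoffel_eq, christoffel_eq,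
    map_add, ← hparξ]
  simp only [add_apply, ContinuousLinearMap.comp_apply, ContinuousLinearMap.flip_apply]
  abel

/-- `(G, J)` is a Kähler structure on the open set `Θ`. -/
structure IsKahlerOn (G : W → W →L[ℝ] W →L[ℝ] ℝ) (J : W → W →L[ℝ] W) (Θ : Set W) : Prop where
  metric : IsMetricOn G Θ
  contDiffAt : ∀ y ∈ Θ, ContDiffAt ℝ ∞ J y
  sq : ∀ y ∈ Θ, ∀ a, J y (J y a) = -a
  hermitian : ∀ y ∈ Θ, ∀ a b, G y (J y a) (J y b) = G y a b
  parallel : ∀ y ∈ Θ, ∀ v w, cov G (fun y' => J y' w) y v = J y (cov G (fun _ => w) y v)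

namespace IsKahlerOn

theorem differentiableAt (h : IsKahlerOn G J Θ) (hy : y ∈ Θ) : DifferentiableAt ℝ J y :=
  (h.contDiffAt y hy).differentiableAt (by simp)

theorem apply_left (h : IsKahlerOn G J Θ) (hy : y ∈ Θ) (a b : W) :
    G y (J y a) b = -G y a (J y b) := by
  rw [← h.hermitian y hy a (J y b), h.sq y hy, map_neg, neg_neg]

theorem apply_self (h : IsKahlerOn G J Θ) (hy : y ∈ Θ) (a : W) : G y (J y a) a = 0 :=
  self_eq_neg.1 ((h.apply_left hy a a).trans (by rw [h.metric.symm y hy a]))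

theorem covAlong_apply (h : IsKahlerOn G J Θ) {u ξ : V → W} {x : V} (hu : DifferentiableAt ℝ u x)
    (hx : u x ∈ Θ) (hξ : DifferentiableAt ℝ ξ x) (v : V) :
    covAlong G u (fun y => J (u y) (ξ y)) x v = J (u x) (covAlong G u ξ x v) :=
  covAlong_parallel (h.differentiableAt hx) hu hξ (h.parallel _ hx) v

theorem curv_self (h : IsKahlerOn G J Θ) (hy : y ∈ Θ) {μ : ℝ} {a : W} (ha : a ≠ 0)
    (hol : sectionalCurv G y a (J y a) = μ) :
    G y (curv G y a (J y a) (J y a)) a = μ * G y a a ^ 2 := by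
  have ha₀ : G y a a ≠ 0 := (h.metric.pos y hy a ha).ne'
  have hperp : G y a (J y a) = 0 := by rw [h.metric.symm y hy, h.apply_self hy]
  rw [sectionalCurv, h.hermitian y hy, hperp, div_eq_iff (by simpa using ha₀)] at hol
  rw [hol]
  ring

variable [FiniteDimensional ℝ W]

theorem curv_apply (h : IsKahlerOn G J Θ) (hy : y ∈ Θ) (v w z : W) :
    curv G y v w (J y z) = J y (curv G y v w z) := by
  have hid : ContDiffAt ℝ ∞ (id : W → W) y := contDiffAt_id
  have hz : ContDiffAt ℝ ∞ (fun _ : W => z) y := contDiffAt_const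
  have hcomm : ∀ v w, covAlong G id (fun y => covAlong G id (fun y => J (id y) z) y w) y v =
      J y (covAlong G id (fun y => covAlong G id (fun _ => z) y w) y v) := by
    intro v w
    have hfirst : (fun y => covAlong G id (fun y => J (id y) z) y w) =ᶠ[𝓝 y] fun y =>
        J (id y) (covAlong G id (fun _ => z) y w) := by
      filter_upwards [h.metric.isOpen.mem_nhds hy] with y hy
      exact h.covAlong_apply (u := id) differentiableAt_id hy (differentiableAt_const z) w
    rw [covAlong_congr hfirst]
    exact h.covAlong_apply (u := id) differentiableAt_id hy
      ((h.metric.contDiffAt_covAlong hid hy hz w).differentiableAt (by simp)) v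
  have hJz := h.metric.covAlong_comm hid hy (ξ := fun y => J (id y) z)
    ((h.contDiffAt y hy).clm_apply hz) v w
  rw [hcomm, hcomm, ← map_sub, h.metric.covAlong_comm hid hy hz] at hJz
  simpa only [fderiv_id, ContinuousLinearMap.id_apply, id] using hJz.symm

end IsKahlerOn

end Kahler

section CurvatureTensor

variable {V : Type*} [NormedAddCommGroup V] [NormedSpace ℝ V] [FiniteDimensional ℝ V]
variable {g : V → V →L[ℝ] V →L[ℝ] ℝ} {J : V → V →L[ℝ] V} {Ω : Set V} {x : V}

namespace IsMetricOn

theorem isLinearMap_curv₁ (hg : IsMetricOn g Ω) (hx : x ∈ Ω) (w z : V) :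
    IsLinearMap ℝ fun v => curv g x v w z where
  map_add a b := by
    simp only [hg.curv_eq hx, map_add, add_apply]
    abel
  map_smul r a := by
    simp only [hg.curv_eq hx, map_smul, smul_apply]
    module

theorem isLinearMap_curv₂ (hg : IsMetricOn g Ω) (hx : x ∈ Ω) (v z : V) :
    IsLinearMap ℝ fun w => curv g x v w z := by
  simp only [fun w => curv_antisymm g x v w z]
  exact (-(hg.isLinearMap_curv₁ hx v z).mk').isLinear

theorem isLinearMap_curv₃ (hg : IsMetricOn g Ω) (hx : x ∈ Ω) (v w : V) :
    IsLinearMap ℝ fun z => curv g x v w z where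
  map_add a b := by
    simp only [hg.curv_eq hx, map_add]
    abel
  map_smul r a := by
    simp only [hg.curv_eq hx, map_smul]
    module

theorem isCurvatureForm (hg : IsMetricOn g Ω) (hx : x ∈ Ω) :
    IsCurvatureForm fun a b c d => g x (curv g x a b c) d where
  add_left a a' b c d := by
    simp only [(hg.isLinearMap_curv₁ hx b c).map_add, map_add, add_apply]
  antisymm_left a b c d := by
    rw [curv_antisymm, map_neg, neg_apply]
  antisymm_right a b c d := hg.curv_skew hx a b c d
  bianchi a b c d := by
    rw [← add_apply, ← add_apply, ← map_add, ← map_add, hg.curv_bianchi hx, map_zero, zero_apply]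

end IsMetricOn

theorem IsKahlerOn.curv_of_holomorphic (h : IsKahlerOn g J Ω) (hx : x ∈ Ω) {μ : ℝ}
    (hol : ∀ a, a ≠ 0 → sectionalCurv g x a (J x a) = μ) (a b c d : V) :
    g x (curv g x a b c) d = μ / 4 * holomorphicCurv (g x) (J x) a b c d := by
  refine (h.metric.isCurvatureForm hx).eq_of_holomorphic
    ((isCurvatureForm_holomorphicCurv (h.metric.symm x hx) (h.apply_left hx)).const_mul (μ / 4))
    (J := (J x : V →+ V)) (h.sq x hx) ?_ ?_ ?_ a b c d
  · intro a b c d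
    change g x (curv g x a b (J x c)) (J x d) = g x (curv g x a b c) d
    rw [h.curv_apply hx, h.hermitian x hx]
  · intro a b c d
    exact congrArg _ (holomorphicCurv_map_map (h.sq x hx) (h.apply_left hx) a b c d)
  · intro a
    rcases eq_or_ne a 0 with rfl | ha
    · simp [holomorphicCurv]
    · simp only [AddMonoidHom.coe_coe, h.curv_self hx ha (hol a ha),
        holomorphicCurv_self (h.metric.symm x hx) (h.sq x hx) (h.apply_left hx)]
      ring

end CurvatureTensor

section Traces

variable {V : Type*} [NormedAddCommGroup V] [NormedSpace ℝ V]

theorem isLinearMap_sum {ι R M N : Type*} [Fintype ι] [Semiring R] [AddCommMonoid M] [Module R M]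
    [AddCommMonoid N] [Module R N] {f : ι → M → N} (hf : ∀ i, IsLinearMap R (f i)) :
    IsLinearMap R fun x => ∑ i, f i x where
  map_add x y := by simp only [(hf _).map_add, Finset.sum_add_distrib]
  map_smul r x := by simp only [(hf _).map_smul, Finset.smul_sum]

theorem exists_orthonormal_basis {V : Type*} [AddCommGroup V] [Module ℝ V] [FiniteDimensional ℝ V]
    (B : V →ₗ[ℝ] V →ₗ[ℝ] ℝ) (hsymm : ∀ v w, B v w = B w v) (hpos : ∀ v, v ≠ 0 → 0 < B v v) :
    ∃ e : Module.Basis (Fin (Module.finrank ℝ V)) ℝ V,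
      ∀ i j, B (e i) (e j) = if i = j then 1 else 0 := by
  let core : InnerProductSpace.Core ℝ V :=
    { inner := fun v w => B v w
      conj_inner_symm := fun v w => hsymm w v
      re_inner_nonneg := fun v => by
        rcases eq_or_ne v 0 with rfl | hv
        · simp
        · exact (hpos v hv).le
      add_left := fun a b c => by simp
      smul_left := fun a b r => by simp
      definite := fun v hv => by_contra fun hv₀ => (hpos v hv₀).ne' hv }
  let _ : NormedAddCommGroup V := core.toNormedAddCommGroup
  let _ : InnerProductSpace ℝ V := InnerProductSpace.ofCore core.toCore
  refine ⟨(stdOrthonormalBasis ℝ V).toBasis, fun i j => ?_⟩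
  rw [OrthonormalBasis.coe_toBasis]
  exact orthonormal_iff_ite.1 (stdOrthonormalBasis ℝ V).orthonormal i j

/-- `e` is an orthonormal basis for the bilinear form `B`, which need not be the inner product of
`V`. -/
def IsOrthonormalFor {ι : Type*} [DecidableEq ι] (B : V →L[ℝ] V →L[ℝ] ℝ)
    (e : Module.Basis ι ℝ V) : Prop :=
  ∀ i j, B (e i) (e j) = if i = j then 1 else 0

theorem IsMetricOn.exists_isOrthonormalFor [FiniteDimensional ℝ V] {g : V → V →L[ℝ] V →L[ℝ] ℝ}
    {Ω : Set V} {x : V} (hg : IsMetricOn g Ω) (hx : x ∈ Ω) :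
    ∃ e : Module.Basis (Fin (Module.finrank ℝ V)) ℝ V, IsOrthonormalFor (g x) e :=
  exists_orthonormal_basis
    (LinearMap.mk₂ ℝ (fun v w => g x v w) (by simp) (by simp) (by simp) (by simp))
    (hg.symm x hx) (hg.pos x hx)

namespace IsOrthonormalFor

variable {ι : Type*} [DecidableEq ι] {B : V →L[ℝ] V →L[ℝ] ℝ} {e : Module.Basis ι ℝ V}

theorem apply_eq_repr (he : IsOrthonormalFor B e) (v : V) (i : ι) : B v (e i) = e.repr v i :=
  LinearMap.congr_fun (e.ext (f₁ := (B.flip (e i)).toLinearMap) (f₂ := e.coord i) fun k => by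
    simp [he k i, Finsupp.single_apply]) v

variable [Fintype ι]

theorem sum_apply_smul (he : IsOrthonormalFor B e) (v : V) : ∑ i, B v (e i) • e i = v := by
  simp only [he.apply_eq_repr, e.sum_repr]

theorem parseval (he : IsOrthonormalFor B e) (v w : V) :
    B v w = ∑ i, B v (e i) * B w (e i) := by
  conv_lhs => rw [← he.sum_apply_smul w]
  simp [mul_comm]

theorem metricTrace_eq [FiniteDimensional ℝ V] {Z : Type*} [AddCommGroup Z] [Module ℝ Z]
    (he : IsOrthonormalFor B e) (hB : B.IsInvertible) {T : V → V → Z}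
    (hleft : ∀ w, IsLinearMap ℝ fun v => T v w) (hright : ∀ v, IsLinearMap ℝ (T v)) :
    metricTrace B T = ∑ i, T (e i) (e i) := by
  let b := Module.finBasis ℝ V
  let T' : V →ₗ[ℝ] V →ₗ[ℝ] Z := LinearMap.mk₂ ℝ T (fun v v' w => (hleft w).map_add v v')
    (fun r v w => (hleft w).map_smul r v) (fun v => (hright v).map_add)
    (fun r v => (hright v).map_smul r)
  have hraise : ∀ i, B.inverse (LinearMap.toContinuousLinearMap (b.coord i)) =
      ∑ l, b.repr (e l) i • e l := fun i => by
    rw [← he.sum_apply_smul (B.inverse _), hB.self_apply_inverse]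
    rfl
  calc metricTrace B T = ∑ i, ∑ l, b.repr (e l) i • T' (b i) (e l) := by
        refine Finset.sum_congr rfl fun i _ => ?_
        change T' (b i) (B.inverse (LinearMap.toContinuousLinearMap (b.coord i))) = _
        rw [hraise]
        simp only [map_sum, map_smul]
    _ = ∑ l, T' (∑ i, b.repr (e l) i • b i) (e l) := by
        rw [Finset.sum_comm]
        simp only [map_sum, map_smul, LinearMap.sum_apply, LinearMap.smul_apply]
    _ = ∑ l, T (e l) (e l) := by
        simp only [b.sum_repr]
        rfl

end IsOrthonormalFor

theorem IsMetricOn.scalarCurv_eq [FiniteDimensional ℝ V] {g : V → V →L[ℝ] V →L[ℝ] ℝ} {Ω : Set V}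
    {x : V} {ι : Type*} [Fintype ι] [DecidableEq ι] {e : Module.Basis ι ℝ V}
    (hg : IsMetricOn g Ω) (hx : x ∈ Ω) (he : IsOrthonormalFor (g x) e) :
    scalarCurv g x = ∑ j, ∑ i, g x (curv g x (e i) (e j) (e j)) (e i) := by
  have hinv := hg.isInvertible hx
  have hcurv₁ : ∀ v w b, IsLinearMap ℝ fun a => g x (curv g x a v w) b := fun v w b =>
    (((g x).flip b).toLinearMap ∘ₗ (hg.isLinearMap_curv₁ hx v w).mk').isLinear
  have hricci : ∀ v w, ricci g x v w = ∑ i, g x (curv g x (e i) v w) (e i) := fun v w =>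
    he.metricTrace_eq hinv (hcurv₁ v w) fun a => (g x (curv g x a v w)).toLinearMap.isLinear
  rw [scalarCurv, he.metricTrace_eq hinv]
  · simp only [hricci]
  · intro w
    simp only [hricci]
    exact isLinearMap_sum fun i =>
      (((g x).flip (e i)).toLinearMap ∘ₗ (hg.isLinearMap_curv₂ hx (e i) w).mk').isLinear
  · intro v
    simp only [funext (hricci v)]
    exact isLinearMap_sum fun i =>
      (((g x).flip (e i)).toLinearMap ∘ₗ (hg.isLinearMap_curv₃ hx (e i) v).mk').isLinear

end Traces

section TotallyReal

variable {V : Type*} [NormedAddCommGroup V] [NormedSpace ℝ V]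
variable {W : Type*} [NormedAddCommGroup W] [NormedSpace ℝ W]
variable {G : W → W →L[ℝ] W →L[ℝ] ℝ} {J : W → W →L[ℝ] W} {Θ : Set W} {u : V → W} {U : Set V}
  {x : V}

/-- `u` immerses `U` into the Kähler domain `Θ`, is totally real at `x ∈ U`, and its `f`-structure
is parallel at `x`. -/
structure IsParallelTotallyRealAt (G : W → W →L[ℝ] W →L[ℝ] ℝ) (J : W → W →L[ℝ] W) (Θ : Set W)
    (u : V → W) (U : Set V) (x : V) : Prop where
  kahler : IsKahlerOn G J Θ
  immersion : IsImmersionInto u U Θ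
  mem : x ∈ U
  real : ∀ v w, G (u x) (J (u x) (fderiv ℝ u x v)) (fderiv ℝ u x w) = 0
  parallel : ParallelFAt G J u x

theorem metricTrace_sff_eq_zero [FiniteDimensional ℝ V] (hmin : meanCurv G u x = 0) :
    metricTrace (inducedMetric G u x) (sff G u x) = 0 := by
  rcases smul_eq_zero.1 hmin with hn | htrace
  · have hrank : Module.finrank ℝ V = 0 := by simpa using hn
    have : IsEmpty (Fin (Module.finrank ℝ V)) := by rw [hrank]; infer_instance
    exact Finset.sum_of_isEmpty _
  · exact htrace

/-- The cubic form `⟨σ(v, w), J t⟩`. -/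
def cubicForm (G : W → W →L[ℝ] W →L[ℝ] ℝ) (J : W → W →L[ℝ] W) (u : V → W) (x v w t : V) : ℝ :=
  G (u x) (sff G u x v w) (J (u x) (fderiv ℝ u x t))

/-- The tangent vector `-J σ(v, w)`: for a parallel `f`-structure, `σ(v, w) = J (shape v w)`, and
`shape v` is the shape operator of the normal vector `J v`. -/
def shape (G : W → W →L[ℝ] W →L[ℝ] ℝ) (J : W → W →L[ℝ] W) (u : V → W) (x v w : V) : V :=
  -tangentialPart G u x (J (u x) (sff G u x v w))

/-- The components of the cubic form in the basis `e`. -/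
def cubicMatrix {ι : Type*} (G : W → W →L[ℝ] W →L[ℝ] ℝ) (J : W → W →L[ℝ] W) (u : V → W) (x : V)
    (e : Module.Basis ι ℝ V) (i : ι) : Matrix ι ι ℝ :=
  Matrix.of fun j k => cubicForm G J u x (e i) (e j) (e k)

namespace IsParallelTotallyRealAt

theorem metric (h : IsParallelTotallyRealAt G J Θ u U x) : IsMetricOn G Θ := h.kahler.metric

theorem map_mem (h : IsParallelTotallyRealAt G J Θ u U x) : u x ∈ Θ := h.immersion.mapsTo x h.mem

theorem contDiffAt (h : IsParallelTotallyRealAt G J Θ u U x) : ContDiffAt ℝ ∞ u x :=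
  h.immersion.contDiffAt x h.mem

theorem induced (h : IsParallelTotallyRealAt G J Θ u U x) : IsMetricOn (inducedMetric G u) U :=
  h.metric.induced h.immersion

theorem cubicForm_symm₁₂ [FiniteDimensional ℝ W] (h : IsParallelTotallyRealAt G J Θ u U x)
    (v w t : V) :
    cubicForm G J u x v w t = cubicForm G J u x w v t := by
  rw [cubicForm, h.metric.sff_symm h.immersion h.mem, cubicForm]

theorem tangentialPart_apply_fderiv [FiniteDimensional ℝ V]
    (h : IsParallelTotallyRealAt G J Θ u U x) (w : V) :
    tangentialPart G u x (J (u x) (J (u x) (fderiv ℝ u x w))) = -w := by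
  rw [h.kahler.sq _ h.map_mem, (isLinearMap_tangentialPart G u x).map_neg,
    h.metric.tangentialPart_fderiv h.immersion h.mem]

variable [FiniteDimensional ℝ V] [FiniteDimensional ℝ W]

-- Parallelism of `f` is applied to the normal extension `ξ = (J w)^⊥` of `J w`.
theorem exists_sff_eq (h : IsParallelTotallyRealAt G J Θ u U x) (v w : V) :
    ∃ a : V, sff G u x v w = J (u x) (fderiv ℝ u x a) ∧
      ∀ s, inducedMetric G u x a s = cubicForm G J u x v s w := by
  let ξ : V → W := fun y => normalPart G u y (J (u x) (fderiv ℝ u x w))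
  have hξ : IsNormalFieldAt G u ξ x :=
    h.metric.isNormalFieldAt_normalPart h.immersion h.mem contDiffAt_const
  have hξx : ξ x = J (u x) (fderiv ℝ u x w) :=
    h.metric.normalPart_of_normal h.immersion h.mem (h.real w)
  have hJξ : ContDiffAt ℝ ∞ (fun y => J (u y) (ξ y)) x :=
    ((h.kahler.contDiffAt _ h.map_mem).comp x h.contDiffAt).clm_apply hξ.1
  let a := tangentialPart G u x (covAlong G u ξ x v)
  have hDf : normalCov G u (fun y => normalF G J u y (ξ y)) x v =
      normalPart G u x (J (u x) (covAlong G u ξ x v)) + sff G u x v w := by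
    simp only [normalF]
    rw [h.metric.normalCov_normalPart h.immersion h.mem hJξ, normalCov, h.kahler.covAlong_apply
      (h.immersion.differentiableAt h.mem) h.map_mem (hξ.1.differentiableAt (by simp)), hξx,
      h.tangentialPart_apply_fderiv, (isLinearMap_sff_right G h.contDiffAt v).map_neg,
      sub_neg_eq_add]
  have hfD : normalF G J u x (normalCov G u ξ x v) =
      normalPart G u x (J (u x) (covAlong G u ξ x v)) - J (u x) (fderiv ℝ u x a) := by
    have hnormal : normalCov G u ξ x v = covAlong G u ξ x v - fderiv ℝ u x a := rfl
    rw [normalF, hnormal, map_sub, (isLinearMap_normalPart G u x).map_sub,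
      h.metric.normalPart_of_normal h.immersion h.mem (h.real _)]
  refine ⟨-a, ?_, fun s => ?_⟩
  · have hpar := h.parallel ξ hξ v
    rw [hDf, hfD, sub_eq_add_neg, add_right_inj] at hpar
    rw [hpar, map_neg, map_neg]
  · rw [map_neg, neg_apply, h.metric.inner_tangentialPart h.immersion h.mem,
      h.metric.weingarten_formula h.immersion h.mem hξ, neg_neg, hξx, cubicForm,
      h.metric.symm _ h.map_mem]

theorem cubicForm_symm₂₃ (h : IsParallelTotallyRealAt G J Θ u U x) (v w t : V) :
    cubicForm G J u x v w t = cubicForm G J u x v t w := by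
  obtain ⟨a, ha, ha'⟩ := h.exists_sff_eq v w
  rw [← ha', cubicForm, ha, h.kahler.hermitian _ h.map_mem, inducedMetric_apply]

theorem sff_eq_shape (h : IsParallelTotallyRealAt G J Θ u U x) (v w : V) :
    sff G u x v w = J (u x) (fderiv ℝ u x (shape G J u x v w)) := by
  obtain ⟨a, ha, -⟩ := h.exists_sff_eq v w
  rw [shape, ha, h.tangentialPart_apply_fderiv, neg_neg]

theorem inner_shape (h : IsParallelTotallyRealAt G J Θ u U x) (v w t : V) :
    inducedMetric G u x (shape G J u x v w) t = cubicForm G J u x v w t := by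
  rw [cubicForm, h.sff_eq_shape, h.kahler.hermitian _ h.map_mem, inducedMetric_apply]

theorem inner_sff_sff (h : IsParallelTotallyRealAt G J Θ u U x) (v w v' w' : V) :
    G (u x) (sff G u x v w) (sff G u x v' w') =
      cubicForm G J u x v w (shape G J u x v' w') := by
  rw [h.sff_eq_shape v' w', cubicForm]

theorem inner_sff_tangentialPart (h : IsParallelTotallyRealAt G J Θ u U x) {ξ : V → W}
    (hξ : IsNormalFieldAt G u ξ x) {a : V} (ha : ξ x = J (u x) (fderiv ℝ u x a)) (v w s : V) :
    G (u x) (sff G u x v (tangentialPart G u x (covAlong G u ξ x w))) (J (u x) (fderiv ℝ u x s)) =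
      -G (u x) (sff G u x w a) (sff G u x v s) := by
  rw [← cubicForm, h.cubicForm_symm₂₃, ← h.inner_shape, h.induced.symm x h.mem,
    h.metric.inner_tangentialPart h.immersion h.mem,
    h.metric.weingarten_formula h.immersion h.mem hξ, ha, h.inner_sff_sff,
    h.metric.symm _ h.map_mem, ← cubicForm, h.cubicForm_symm₂₃]

-- `a ↦ J a` intertwines the tangential and the normal curvature, so the Ricci equation reduces to
-- the Gauss equation.
theorem inner_normalCurv (h : IsParallelTotallyRealAt G J Θ u U x) {ξ : V → W}
    (hξ : IsNormalFieldAt G u ξ x) {a : V} (ha : ξ x = J (u x) (fderiv ℝ u x a)) (v w s : V) :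
    G (u x) (normalCurv G u ξ x v w) (J (u x) (fderiv ℝ u x s)) =
      inducedMetric G u x (curv (inducedMetric G u) x v w a) s := by
  rw [h.metric.ricci_equation h.immersion h.mem hξ.1, map_add, map_sub, add_apply, sub_apply,
    h.metric.inner_normalPart_of_normal h.immersion h.mem (h.real s),
    h.inner_sff_tangentialPart hξ ha, h.inner_sff_tangentialPart hξ ha, ha,
    h.kahler.curv_apply h.map_mem, h.kahler.hermitian _ h.map_mem,
    h.metric.gauss_equation h.immersion h.mem]
  ring

theorem inner_curv_shape (h : IsParallelTotallyRealAt G J Θ u U x) (hsemi : SemiparallelAt G u x)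
    (v w z t s : V) :
    inducedMetric G u x (curv (inducedMetric G u) x v w (shape G J u x z t)) s =
      cubicForm G J u x (curv (inducedMetric G u) x v w z) t s
      + cubicForm G J u x z (curv (inducedMetric G u) x v w t) s := by
  rw [← h.inner_normalCurv (h.metric.isNormalFieldAt_sff h.immersion h.mem z t)
    (h.sff_eq_shape z t), cubicForm, cubicForm, ← add_apply, ← map_add]
  congr 2
  exact sub_eq_zero.1 ((sub_add_eq_sub_sub _ _ _).trans (hsemi v w z t))

section OrthonormalBasis

variable {ι : Type*} [Fintype ι] [DecidableEq ι] {e : Module.Basis ι ℝ V}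

theorem cubicForm_eq_sum (h : IsParallelTotallyRealAt G J Θ u U x)
    (he : IsOrthonormalFor (inducedMetric G u x) e) (v w t : V) :
    cubicForm G J u x v w t = ∑ m, inducedMetric G u x t (e m) * cubicForm G J u x v w (e m) := by
  rw [← h.inner_shape, h.induced.symm x h.mem, he.parseval]
  simp only [h.inner_shape]

theorem inner_sff_sff_eq_sum (h : IsParallelTotallyRealAt G J Θ u U x)
    (he : IsOrthonormalFor (inducedMetric G u x) e) (i j k l : ι) :
    G (u x) (sff G u x (e i) (e j)) (sff G u x (e k) (e l)) =
      (cubicMatrix G J u x e i * cubicMatrix G J u x e k) j l := by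
  rw [h.inner_sff_sff, h.cubicForm_eq_sum he, Matrix.mul_apply]
  simp only [h.inner_shape, cubicMatrix, Matrix.of_apply]
  refine Finset.sum_congr rfl fun m _ => ?_
  rw [h.cubicForm_symm₂₃ (e k), mul_comm]

theorem inducedMetric_curv (h : IsParallelTotallyRealAt G J Θ u U x)
    (he : IsOrthonormalFor (inducedMetric G u x) e) {μ : ℝ}
    (hol : ∀ a, a ≠ 0 → sectionalCurv G (u x) a (J (u x) a) = μ) (v w z t : ι) :
    inducedMetric G u x (curv (inducedMetric G u) x (e v) (e w) (e z)) (e t) =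
      gaussCurv (μ / 4) (cubicMatrix G J u x e) v w z t := by
  have hreal (a b : V) : G (u x) (fderiv ℝ u x a) (J (u x) (fderiv ℝ u x b)) = 0 :=
    (h.metric.symm _ h.map_mem _ _).trans (h.real b a)
  rw [h.metric.gauss_equation h.immersion h.mem, h.kahler.curv_of_holomorphic h.map_mem hol,
    h.inner_sff_sff_eq_sum he, h.inner_sff_sff_eq_sum he]
  simp only [holomorphicCurv, h.real, hreal, ← inducedMetric_apply, he _ _, gaussCurv,
    unitCurv_apply, ite_and, boole_mul, Ring.lie_def, Matrix.add_apply, Matrix.smul_apply,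
    Matrix.sub_apply, smul_eq_mul]
  ring

theorem cubicForm_curv_eq_sum (h : IsParallelTotallyRealAt G J Θ u U x)
    (he : IsOrthonormalFor (inducedMetric G u x) e) {μ : ℝ}
    (hol : ∀ a, a ≠ 0 → sectionalCurv G (u x) a (J (u x) a) = μ) (i j v w z : ι) :
    cubicForm G J u x (e i) (e j) (curv (inducedMetric G u) x (e v) (e w) (e z)) =
      ∑ m, gaussCurv (μ / 4) (cubicMatrix G J u x e) v w z m * cubicMatrix G J u x e i j m := by
  rw [h.cubicForm_eq_sum he]
  simp only [h.inducedMetric_curv he hol, cubicMatrix, Matrix.of_apply]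

theorem isHarmonicCubic (h : IsParallelTotallyRealAt G J Θ u U x)
    (he : IsOrthonormalFor (inducedMetric G u x) e) (hmin : meanCurv G u x = 0) :
    IsHarmonicCubic (cubicMatrix G J u x e) where
  symm₁₂ i j k := h.cubicForm_symm₁₂ _ _ _
  symm₂₃ i j k := h.cubicForm_symm₂₃ _ _ _
  trace k := by
    have htrace := metricTrace_sff_eq_zero hmin
    rw [he.metricTrace_eq (h.induced.isInvertible h.mem) (isLinearMap_sff_left G h.contDiffAt)
      (isLinearMap_sff_right G h.contDiffAt)] at htrace
    simpa [cubicMatrix, cubicForm] using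
      congrArg (fun a => G (u x) a (J (u x) (fderiv ℝ u x (e k)))) htrace

theorem sffNormSq_eq (h : IsParallelTotallyRealAt G J Θ u U x)
    (he : IsOrthonormalFor (inducedMetric G u x) e) :
    sffNormSq G u x = cubicNormSq (cubicMatrix G J u x e) := by
  have hinv := h.induced.isInvertible h.mem
  have hinner (v v' : V) : metricTrace (inducedMetric G u x)
      (fun w w' => G (u x) (sff G u x v w) (sff G u x v' w')) =
        ∑ j, G (u x) (sff G u x v (e j)) (sff G u x v' (e j)) :=
    he.metricTrace_eq hinv
      (fun w' => (((G (u x)).flip (sff G u x v' w')).toLinearMap ∘ₗ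
        (isLinearMap_sff_right G h.contDiffAt v).mk').isLinear)
      fun w => ((G (u x) (sff G u x v w)).toLinearMap ∘ₗ
        (isLinearMap_sff_right G h.contDiffAt v').mk').isLinear
  simp only [sffNormSq, hinner]
  rw [he.metricTrace_eq hinv]
  · simp only [h.inner_sff_sff_eq_sum he]
    rfl
  · exact fun v' => isLinearMap_sum fun j => (((G (u x)).flip (sff G u x v' (e j))).toLinearMap ∘ₗ
      (isLinearMap_sff_left G h.contDiffAt (e j)).mk').isLinear
  · exact fun v => isLinearMap_sum fun j => ((G (u x) (sff G u x v (e j))).toLinearMap ∘ₗ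
      (isLinearMap_sff_left G h.contDiffAt (e j)).mk').isLinear

theorem isSemiparallelCubic (h : IsParallelTotallyRealAt G J Θ u U x)
    (he : IsOrthonormalFor (inducedMetric G u x) e) {μ : ℝ}
    (hol : ∀ a, a ≠ 0 → sectionalCurv G (u x) a (J (u x) a) = μ) (hsemi : SemiparallelAt G u x) :
    IsSemiparallelCubic (gaussCurv (μ / 4) (cubicMatrix G J u x e)) (cubicMatrix G J u x e) := by
  intro v w z
  ext t s
  have hR := h.induced.curv_skew h.mem (e v) (e w)
  have hskew (m : ι) : gaussCurv (μ / 4) (cubicMatrix G J u x e) v w m s =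
      -gaussCurv (μ / 4) (cubicMatrix G J u x e) v w s m := by
    rw [← h.inducedMetric_curv he hol, ← h.inducedMetric_curv he hol, hR]
  have hsemi' := h.inner_curv_shape hsemi (e v) (e w) (e z) (e t) (e s)
  rw [hR, h.induced.symm x h.mem, h.inner_shape, h.cubicForm_symm₁₂ (curv _ _ _ _ _),
    h.cubicForm_symm₂₃ _ (curv _ _ _ _ _), h.cubicForm_symm₂₃ _ (curv _ _ _ _ _),
    h.cubicForm_curv_eq_sum he hol, h.cubicForm_curv_eq_sum he hol,
    h.cubicForm_curv_eq_sum he hol] at hsemi'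
  have hcycle (m : ι) : cubicMatrix G J u x e m t s = cubicMatrix G J u x e t s m :=
    (h.cubicForm_symm₁₂ _ _ _).trans (h.cubicForm_symm₂₃ _ _ _)
  have hswap (m : ι) : cubicMatrix G J u x e z m s = cubicMatrix G J u x e z s m :=
    h.cubicForm_symm₂₃ _ _ _
  simp only [Ring.lie_def, Matrix.sub_apply, Matrix.mul_apply, Matrix.sum_apply, Matrix.smul_apply,
    smul_eq_mul, hskew, hcycle, hswap, neg_mul, Finset.sum_neg_distrib,
    mul_comm (cubicMatrix G J u x e z t _)]
  linarith

end OrthonormalBasis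

theorem scalarCurv_eq (h : IsParallelTotallyRealAt G J Θ u U x) {μ : ℝ}
    (hol : ∀ a, a ≠ 0 → sectionalCurv G (u x) a (J (u x) a) = μ) (hmin : meanCurv G u x = 0) :
    scalarCurv (inducedMetric G u) x =
      Module.finrank ℝ V * (Module.finrank ℝ V - 1) * (μ / 4) - sffNormSq G u x := by
  obtain ⟨e, he⟩ := h.induced.exists_isOrthonormalFor h.mem
  rw [h.induced.scalarCurv_eq h.mem he, h.sffNormSq_eq he, Finset.sum_comm]
  simp only [h.inducedMetric_curv he hol, (h.isHarmonicCubic he hmin).sum_gaussCurv_apply,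
    Fintype.card_fin]

theorem sffNormSq_sq_le (h : IsParallelTotallyRealAt G J Θ u U x) {μ : ℝ}
    (hol : ∀ a, a ≠ 0 → sectionalCurv G (u x) a (J (u x) a) = μ) (hmin : meanCurv G u x = 0)
    (hsemi : SemiparallelAt G u x) :
    sffNormSq G u x ^ 2 ≤
      Module.finrank ℝ V * (Module.finrank ℝ V - 1) * (μ / 4) * sffNormSq G u x := by
  obtain ⟨e, he⟩ := h.induced.exists_isOrthonormalFor h.mem
  rw [h.sffNormSq_eq he]
  simpa using (h.isHarmonicCubic he hmin).cubicNormSq_sq_le (h.isSemiparallelCubic he hol hsemi)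

theorem sffNormSq_nonneg (h : IsParallelTotallyRealAt G J Θ u U x) (hmin : meanCurv G u x = 0) :
    0 ≤ sffNormSq G u x := by
  obtain ⟨e, he⟩ := h.induced.exists_isOrthonormalFor h.mem
  exact (h.isHarmonicCubic he hmin).cubicNormSq_nonneg.trans_eq (h.sffNormSq_eq he).symm

theorem sff_eq_zero (h : IsParallelTotallyRealAt G J Θ u U x) (hmin : meanCurv G u x = 0)
    (hS : sffNormSq G u x = 0) (v w : V) : sff G u x v w = 0 := by
  obtain ⟨e, he⟩ := h.induced.exists_isOrthonormalFor h.mem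
  let σ : V →ₗ[ℝ] V →ₗ[ℝ] W := LinearMap.mk₂ ℝ (sff G u x)
    (fun a b c => (isLinearMap_sff_left G h.contDiffAt c).map_add a b)
    (fun r a b => (isLinearMap_sff_left G h.contDiffAt b).map_smul r a)
    (fun a => (isLinearMap_sff_right G h.contDiffAt a).map_add)
    (fun r a => (isLinearMap_sff_right G h.contDiffAt a).map_smul r)
  have hC (i j k) : cubicForm G J u x (e i) (e j) (e k) = 0 :=
    congrFun₂ ((h.isHarmonicCubic he hmin).eq_zero_of_cubicNormSq
      ((h.sffNormSq_eq he).symm.trans hS) i) j k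
  have hσ : σ = 0 := e.ext fun i => e.ext fun j => by
    change sff G u x (e i) (e j) = 0
    rw [h.sff_eq_shape, ← he.sum_apply_smul (shape G J u x (e i) (e j))]
    simp only [h.inner_shape, hC, zero_smul, Finset.sum_const_zero, map_zero]
  exact LinearMap.congr_fun₂ hσ v w

theorem curv_eq_zero (h : IsParallelTotallyRealAt G J Θ u U x) {μ : ℝ}
    (hol : ∀ a, a ≠ 0 → sectionalCurv G (u x) a (J (u x) a) = μ) (hmin : meanCurv G u x = 0)
    (hsemi : SemiparallelAt G u x) (hτ : scalarCurv (inducedMetric G u) x = 0) (v w z : V) :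
    curv (inducedMetric G u) x v w z = 0 := by
  obtain ⟨e, he⟩ := h.induced.exists_isOrthonormalFor h.mem
  have hgauss := (h.isHarmonicCubic he hmin).gaussCurv_eq_zero (h.isSemiparallelCubic he hol hsemi)
    (by rw [← h.sffNormSq_eq he, eq_comm, ← sub_eq_zero, Fintype.card_fin,
      ← h.scalarCurv_eq hol hmin, hτ])
  have hbasis (i j k) : curv (inducedMetric G u) x (e i) (e j) (e k) = 0 := by
    rw [← he.sum_apply_smul (curv _ _ _ _ _)]
    simp only [h.inducedMetric_curv he hol, hgauss, Matrix.zero_apply, zero_smul,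
      Finset.sum_const_zero]
  have hbasis₃ (i j) : curv (inducedMetric G u) x (e i) (e j) z = 0 := LinearMap.congr_fun
    (e.ext (f₁ := (h.induced.isLinearMap_curv₃ h.mem (e i) (e j)).mk') (f₂ := 0) (hbasis i j)) z
  have hbasis₂ (i) : curv (inducedMetric G u) x (e i) w z = 0 := LinearMap.congr_fun
    (e.ext (f₁ := (h.induced.isLinearMap_curv₂ h.mem (e i) z).mk') (f₂ := 0) (hbasis₃ i)) w
  exact LinearMap.congr_fun
    (e.ext (f₁ := (h.induced.isLinearMap_curv₁ h.mem w z).mk') (f₂ := 0) hbasis₂) v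

end IsParallelTotallyRealAt

end TotallyReal

section Charts

variable {E : Type*} [NormedAddCommGroup E] [NormedSpace ℝ E]
variable {M : Type*} [TopologicalSpace M] [ChartedSpace E M]
variable {E' : Type*} [NormedAddCommGroup E'] [NormedSpace ℝ E']
variable {N : Type*} [TopologicalSpace N] [ChartedSpace E' N]

section ChartDerivatives

variable [IsManifold 𝓘(ℝ, E') ∞ N] {q : N} {y : E'}

theorem contMDiffAt_extChartAt_symm (hy : y ∈ (extChartAt 𝓘(ℝ, E') q).target) :
    ContMDiffAt 𝓘(ℝ, E') 𝓘(ℝ, E') ∞ (extChartAt 𝓘(ℝ, E') q).symm y :=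
  (contMDiffOn_extChartAt_symm q).contMDiffAt ((isOpen_extChartAt_target q).mem_nhds hy)

theorem contMDiffAt_tangentMap [IsManifold 𝓘(ℝ, E) ∞ M] {X : Type*} [NormedAddCommGroup X]
    [NormedSpace ℝ X] {f : M → N} {s : Set M} (hs : IsOpen s)
    (hf : ContMDiffOn 𝓘(ℝ, E) 𝓘(ℝ, E') ∞ f s) {ζ : X → TangentBundle 𝓘(ℝ, E) M} {x : X}
    (hζ : ContMDiffAt 𝓘(ℝ, X) 𝓘(ℝ, E).tangent ∞ ζ x) (hx : (ζ x).proj ∈ s) :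
    ContMDiffAt 𝓘(ℝ, X) 𝓘(ℝ, E').tangent ∞ (fun y => tangentMap 𝓘(ℝ, E) 𝓘(ℝ, E') f (ζ y)) x := by
  have hnhds : (Bundle.TotalSpace.proj ⁻¹' s : Set (TangentBundle 𝓘(ℝ, E) M)) ∈ 𝓝 (ζ x) :=
    (hs.preimage (FiberBundle.continuous_proj E (TangentSpace 𝓘(ℝ, E)))).mem_nhds hx
  have hwithin : tangentMapWithin 𝓘(ℝ, E) 𝓘(ℝ, E') f s
      =ᶠ[𝓝 (ζ x)] tangentMap 𝓘(ℝ, E) 𝓘(ℝ, E') f := by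
    filter_upwards [hnhds] with p hp
    simp only [tangentMapWithin, tangentMap, mfderivWithin_of_isOpen hs hp]
  exact (((hf.contMDiffOn_tangentMapWithin (m := ∞) (by simp) hs.uniqueMDiffOn).contMDiffAt
    hnhds).congr_of_eventuallyEq hwithin.symm).comp x hζ

/-- The differential of the chart at `q`, with values in the model space: it sends a tangent vector
at `r` to its components. -/
def chartDeriv (q r : N) : TangentSpace 𝓘(ℝ, E') r →L[ℝ] E' :=
  mfderiv 𝓘(ℝ, E') 𝓘(ℝ, E') (extChartAt 𝓘(ℝ, E') q) r

/-- The differential of the inverse of the chart at `q`, on the model space: it sends `a` to the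
tangent vector with components `a`. -/
def chartSymmDeriv (q : N) (y : E') :
    E' →L[ℝ] TangentSpace 𝓘(ℝ, E') ((extChartAt 𝓘(ℝ, E') q).symm y) :=
  mfderiv 𝓘(ℝ, E') 𝓘(ℝ, E') (extChartAt 𝓘(ℝ, E') q).symm y

theorem chartDeriv_chartSymmDeriv (hy : y ∈ (extChartAt 𝓘(ℝ, E') q).target) (a : E') :
    chartDeriv q ((extChartAt 𝓘(ℝ, E') q).symm y) (chartSymmDeriv q y a) = a := by
  have h := mfderiv_extChartAt_comp_mfderivWithin_extChartAt_symm (I := 𝓘(ℝ, E')) (x := q) hy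
  rw [ModelWithCorners.range_eq_univ, mfderivWithin_univ] at h
  exact congrArg (fun T : E' →L[ℝ] E' => T a) h

theorem chartSymmDeriv_chartDeriv (hy : y ∈ (extChartAt 𝓘(ℝ, E') q).target)
    (a : TangentSpace 𝓘(ℝ, E') ((extChartAt 𝓘(ℝ, E') q).symm y)) :
    chartSymmDeriv q y (chartDeriv q ((extChartAt 𝓘(ℝ, E') q).symm y) a) = a := by
  have h := mfderivWithin_extChartAt_symm_comp_mfderiv_extChartAt (I := 𝓘(ℝ, E')) (x := q) hy
  rw [ModelWithCorners.range_eq_univ, mfderivWithin_univ] at h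
  exact congrArg (fun T : E' →L[ℝ] E' => T a) h

theorem injective_chartSymmDeriv (hy : y ∈ (extChartAt 𝓘(ℝ, E') q).target) :
    Function.Injective (chartSymmDeriv q y) :=
  Function.LeftInverse.injective (chartDeriv_chartSymmDeriv hy)

theorem injective_chartDeriv {r : N} (hr : r ∈ (extChartAt 𝓘(ℝ, E') q).source) :
    Function.Injective (chartDeriv (E' := E') q r) :=
  (isInvertible_mfderiv_extChartAt hr).injective

theorem contMDiffAt_chartSymmDeriv_apply (hy : y ∈ (extChartAt 𝓘(ℝ, E') q).target) (a : E') :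
    ContMDiffAt 𝓘(ℝ, E') 𝓘(ℝ, E').tangent ∞
      (fun z => (TotalSpace.mk' E' ((extChartAt 𝓘(ℝ, E') q).symm z) (chartSymmDeriv q z a) :
        TangentBundle 𝓘(ℝ, E') N)) y :=
  contMDiffAt_tangentMap (ζ := fun z => (TotalSpace.mk' E' z a : TangentBundle 𝓘(ℝ, E') E'))
    (isOpen_extChartAt_target q) (contMDiffOn_extChartAt_symm q)
    (contMDiffAt_vectorSpace_iff_contDiffAt.2 contDiffAt_const) hy

end ChartDerivatives

section ChartFields

variable [IsManifold 𝓘(ℝ, E') ∞ N] {q r : N} {y : E'}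
  {g : ContMDiffRiemannianMetric 𝓘(ℝ, E') ∞ E' (fun q : N => TangentSpace 𝓘(ℝ, E') q)}
  {J : ∀ q : N, TangentSpace 𝓘(ℝ, E') q →L[ℝ] TangentSpace 𝓘(ℝ, E') q}

theorem chartMetric_apply (y a b : E') :
    chartMetric g q y a b =
      g.inner ((extChartAt 𝓘(ℝ, E') q).symm y) (chartSymmDeriv q y a) (chartSymmDeriv q y b) :=
  rfl

theorem chartSymmDeriv_chartEnd (hy : y ∈ (extChartAt 𝓘(ℝ, E') q).target) (a : E') :
    chartSymmDeriv q y (chartEnd J q y a) = J _ (chartSymmDeriv q y a) :=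
  chartSymmDeriv_chartDeriv hy _

theorem contDiffAt_chartMetric_apply (hy : y ∈ (extChartAt 𝓘(ℝ, E') q).target) (a b : E') :
    ContDiffAt ℝ ∞ (fun z => chartMetric g q z a b) y := by
  have hmetric : ContMDiffAt 𝓘(ℝ, E') (𝓘(ℝ, E').prod 𝓘(ℝ)) ∞
      (fun z => TotalSpace.mk' ℝ (E := Bundle.Trivial N ℝ) ((extChartAt 𝓘(ℝ, E') q).symm z)
        (g.inner ((extChartAt 𝓘(ℝ, E') q).symm z) (chartSymmDeriv q z a)
          (chartSymmDeriv q z b))) y :=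
    ContMDiffAt.clm_bundle_apply₂ (F₁ := E') (F₂ := E')
      (ContMDiffAt.comp y g.contMDiff.contMDiffAt (contMDiffAt_extChartAt_symm hy))
      (contMDiffAt_chartSymmDeriv_apply hy a) (contMDiffAt_chartSymmDeriv_apply hy b)
  rw [contMDiffAt_totalSpace] at hmetric
  exact hmetric.2.contDiffAt

theorem contDiffAt_chartEnd_apply
    (hJ : ContMDiff 𝓘(ℝ, E') (𝓘(ℝ, E').prod 𝓘(ℝ, E' →L[ℝ] E')) ∞
      (fun q => TotalSpace.mk' (E' →L[ℝ] E')
        (E := fun q : N => TangentSpace 𝓘(ℝ, E') q →L[ℝ] TangentSpace 𝓘(ℝ, E') q) q (J q)))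
    (hy : y ∈ (extChartAt 𝓘(ℝ, E') q).target) (a : E') :
    ContDiffAt ℝ ∞ (fun z => chartEnd J q z a) y := by
  have hfield : ContMDiffAt 𝓘(ℝ, E') 𝓘(ℝ, E').tangent ∞
      (fun z => (TotalSpace.mk' E' ((extChartAt 𝓘(ℝ, E') q).symm z)
        (J _ (chartSymmDeriv q z a)) : TangentBundle 𝓘(ℝ, E') N)) y :=
    ContMDiffAt.clm_bundle_apply (F₁ := E')
      (ContMDiffAt.comp y hJ.contMDiffAt (contMDiffAt_extChartAt_symm hy))
      (contMDiffAt_chartSymmDeriv_apply hy a)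
  have hchart := contMDiffAt_tangentMap (isOpen_extChartAt_source (I := 𝓘(ℝ, E')) q)
    (extChartAt_source (I := 𝓘(ℝ, E')) q ▸ contMDiffOn_extChartAt) hfield
    ((extChartAt 𝓘(ℝ, E') q).map_target hy)
  exact ((contMDiff_snd_tangentBundle_modelSpace E' 𝓘(ℝ, E')).contMDiffAt.comp y
    hchart).contDiffAt

theorem chartMetric_chartDeriv (hr : r ∈ (extChartAt 𝓘(ℝ, E') q).source)
    (a b : TangentSpace 𝓘(ℝ, E') r) :
    chartMetric g q (extChartAt 𝓘(ℝ, E') q r) (chartDeriv q r a) (chartDeriv q r b) =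
      g.inner r a b := by
  obtain ⟨y, hy, rfl⟩ : ∃ y ∈ (extChartAt 𝓘(ℝ, E') q).target, (extChartAt 𝓘(ℝ, E') q).symm y = r :=
    ⟨_, (extChartAt 𝓘(ℝ, E') q).map_source hr, (extChartAt 𝓘(ℝ, E') q).left_inv hr⟩
  rw [(extChartAt 𝓘(ℝ, E') q).right_inv hy, chartMetric_apply, chartSymmDeriv_chartDeriv hy,
    chartSymmDeriv_chartDeriv hy]

theorem chartEnd_chartDeriv (hr : r ∈ (extChartAt 𝓘(ℝ, E') q).source)
    (a : TangentSpace 𝓘(ℝ, E') r) :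
    chartEnd J q (extChartAt 𝓘(ℝ, E') q r) (chartDeriv q r a) = chartDeriv q r (J r a) := by
  obtain ⟨y, hy, rfl⟩ : ∃ y ∈ (extChartAt 𝓘(ℝ, E') q).target, (extChartAt 𝓘(ℝ, E') q).symm y = r :=
    ⟨_, (extChartAt 𝓘(ℝ, E') q).map_source hr, (extChartAt 𝓘(ℝ, E') q).left_inv hr⟩
  rw [(extChartAt 𝓘(ℝ, E') q).right_inv hy]
  refine injective_chartSymmDeriv hy ?_
  rw [chartSymmDeriv_chartEnd hy, chartSymmDeriv_chartDeriv hy, chartSymmDeriv_chartDeriv hy]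

theorem chartEnd_extChartAt_self (q : N) (a : E') :
    chartEnd J q (extChartAt 𝓘(ℝ, E') q q) a = J q a := by
  have hself (b : TangentSpace 𝓘(ℝ, E') q) : chartDeriv q q b = b := by
    rw [chartDeriv, mfderiv_extChartAt_self]
    rfl
  have h := chartEnd_chartDeriv (J := J) (mem_extChartAt_source (I := 𝓘(ℝ, E')) q) a
  exact (congrArg (chartEnd J q _) (hself a)).symm.trans (h.trans (hself _))

variable [FiniteDimensional ℝ E']

theorem isMetricOn_chartMetric (q : N) :
    IsMetricOn (chartMetric g q) (extChartAt 𝓘(ℝ, E') q).target where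
  isOpen := isOpen_extChartAt_target q
  contDiffAt _ hy := (contDiffOn_clm_apply.2 fun a => contDiffOn_clm_apply.2 fun b _ hz =>
    (contDiffAt_chartMetric_apply hz a b).contDiffWithinAt).contDiffAt
      ((isOpen_extChartAt_target q).mem_nhds hy)
  symm y _ a b := g.symm _ (chartSymmDeriv q y a) (chartSymmDeriv q y b)
  pos y hy a ha := g.pos _ (chartSymmDeriv q y a)
    ((injective_chartSymmDeriv hy).ne_iff' (map_zero _) |>.2 ha)

theorem IsKahler.isKahlerOn (h : IsKahler g J) (q : N) :
    IsKahlerOn (chartMetric g q) (chartEnd J q) (extChartAt 𝓘(ℝ, E') q).target where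
  metric := isMetricOn_chartMetric q
  contDiffAt _ hy := (contDiffOn_clm_apply.2 fun a _ hz =>
    (contDiffAt_chartEnd_apply h.smooth hz a).contDiffWithinAt).contDiffAt
      ((isOpen_extChartAt_target q).mem_nhds hy)
  sq y hy a := injective_chartSymmDeriv hy <| by
    rw [chartSymmDeriv_chartEnd hy, chartSymmDeriv_chartEnd hy, h.sq, map_neg]
  hermitian y hy a b := by
    rw [chartMetric_apply, chartSymmDeriv_chartEnd hy, chartSymmDeriv_chartEnd hy, h.hermitian,
      chartMetric_apply]
  parallel y hy v w := h.parallel q y hy v w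

end ChartFields

section ChartExpression

variable {F : M → N} {p : M} {x : E}

/-- The coordinate domain on which `F` is read in the preferred charts at `p` and `F p`. -/
def chartDomain (E' : Type*) [NormedAddCommGroup E'] [NormedSpace ℝ E'] {N : Type*}
    [TopologicalSpace N] [ChartedSpace E' N] (F : M → N) (p : M) : Set E :=
  (extChartAt 𝓘(ℝ, E) p).target ∩
    (extChartAt 𝓘(ℝ, E) p).symm ⁻¹' (F ⁻¹' (extChartAt 𝓘(ℝ, E') (F p)).source)

theorem mem_chartDomain (F : M → N) (p : M) :
    extChartAt 𝓘(ℝ, E) p p ∈ chartDomain (E := E) E' F p :=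
  ⟨mem_extChartAt_target p, by simp⟩

theorem isOpen_chartDomain (hF : Continuous F) (p : M) : IsOpen (chartDomain (E := E) E' F p) :=
  (continuousOn_extChartAt_symm p).isOpen_inter_preimage (isOpen_extChartAt_target p)
    ((isOpen_extChartAt_source (I := 𝓘(ℝ, E')) (F p)).preimage hF)

variable [IsManifold 𝓘(ℝ, E') ∞ N]

theorem contMDiffAt_extChartAt_of_mem_chartDomain (hx : x ∈ chartDomain (E := E) E' F p) :
    ContMDiffAt 𝓘(ℝ, E') 𝓘(ℝ, E') ∞ (extChartAt 𝓘(ℝ, E') (F p))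
      (F ((extChartAt 𝓘(ℝ, E) p).symm x)) :=
  contMDiffAt_extChartAt' (by simpa [extChartAt_source] using hx.2)

variable [IsManifold 𝓘(ℝ, E) ∞ M]

theorem contMDiffAt_writtenInExtChartAt (hF : ContMDiff 𝓘(ℝ, E) 𝓘(ℝ, E') ∞ F)
    (hx : x ∈ chartDomain (E := E) E' F p) :
    ContMDiffAt 𝓘(ℝ, E) 𝓘(ℝ, E') ∞ (writtenInExtChartAt 𝓘(ℝ, E) 𝓘(ℝ, E') p F) x :=
  (contMDiffAt_extChartAt_of_mem_chartDomain hx).comp x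
    (hF.contMDiffAt.comp x (contMDiffAt_extChartAt_symm hx.1))

theorem fderiv_writtenInExtChartAt (hF : ContMDiff 𝓘(ℝ, E) 𝓘(ℝ, E') ∞ F)
    (hx : x ∈ chartDomain (E := E) E' F p) (v : E) :
    fderiv ℝ (writtenInExtChartAt 𝓘(ℝ, E) 𝓘(ℝ, E') p F) x v =
      chartDeriv (F p) (F ((extChartAt 𝓘(ℝ, E) p).symm x))
        (mfderiv 𝓘(ℝ, E) 𝓘(ℝ, E') F ((extChartAt 𝓘(ℝ, E) p).symm x) (chartSymmDeriv p x v)) := by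
  have hcomp := ((contMDiffAt_extChartAt_of_mem_chartDomain hx).mdifferentiableAt
    (by simp)).hasMFDerivAt.comp x ((hF.contMDiffAt.mdifferentiableAt (by simp)).hasMFDerivAt.comp x
      ((contMDiffAt_extChartAt_symm hx.1).mdifferentiableAt (by simp)).hasMFDerivAt)
  rw [← mfderiv_eq_fderiv]
  exact congrArg (fun T : E →L[ℝ] E' => T v) hcomp.mfderiv

theorem isImmersionInto_writtenInExtChartAt
    (hF : IsSmoothImmersion (E := E) (E' := E') F) (p : M) :
    IsImmersionInto (writtenInExtChartAt 𝓘(ℝ, E) 𝓘(ℝ, E') p F) (chartDomain (E := E) E' F p)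
      (extChartAt 𝓘(ℝ, E') (F p)).target where
  isOpen := isOpen_chartDomain hF.1.continuous p
  contDiffAt x hx := (contMDiffAt_writtenInExtChartAt hF.1 hx).contDiffAt
  mapsTo x hx := (extChartAt 𝓘(ℝ, E') (F p)).map_source hx.2
  injective x hx := by
    rw [funext (fderiv_writtenInExtChartAt hF.1 hx)]
    exact (injective_chartDeriv hx.2).comp ((hF.2 _).comp (injective_chartSymmDeriv hx.1))

variable [FiniteDimensional ℝ E']
  {g : ContMDiffRiemannianMetric 𝓘(ℝ, E') ∞ E' (fun q : N => TangentSpace 𝓘(ℝ, E') q)}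
  {J : ∀ q : N, TangentSpace 𝓘(ℝ, E') q →L[ℝ] TangentSpace 𝓘(ℝ, E') q}

theorem IsTotallyReal.isParallelTotallyRealAt (hreal : IsTotallyReal (E := E) g J F)
    (hK : IsKahler g J) (hF : IsSmoothImmersion (E := E) (E' := E') F)
    (hf : HasParallelF (E := E) g J F) (p : M) :
    IsParallelTotallyRealAt (chartMetric g (F p)) (chartEnd J (F p))
      (extChartAt 𝓘(ℝ, E') (F p)).target (writtenInExtChartAt 𝓘(ℝ, E) 𝓘(ℝ, E') p F)
      (chartDomain (E := E) E' F p) (extChartAt 𝓘(ℝ, E) p p) where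
  kahler := hK.isKahlerOn (F p)
  immersion := isImmersionInto_writtenInExtChartAt hF p
  mem := mem_chartDomain F p
  real v w := by
    have hx := mem_chartDomain (E := E) (E' := E') F p
    rw [fderiv_writtenInExtChartAt hF.1 hx, fderiv_writtenInExtChartAt hF.1 hx]
    refine (congrArg (fun c => chartMetric g (F p) _ c _) (chartEnd_chartDeriv hx.2 _)).trans ?_
    exact (chartMetric_chartDeriv hx.2 _ _).trans (hreal _ _ _)
  parallel := hf p

end ChartExpression

end Charts

section ComplexSpaceForms

variable {E : Type*} [NormedAddCommGroup E] [NormedSpace ℝ E]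
variable {M : Type*} [TopologicalSpace M] [ChartedSpace E M]
variable {E' : Type*} [NormedAddCommGroup E'] [NormedSpace ℝ E']
variable {N : Type*} [TopologicalSpace N] [ChartedSpace E' N] [IsManifold 𝓘(ℝ, E') ∞ N]
variable {g : ContMDiffRiemannianMetric 𝓘(ℝ, E') ∞ E' (fun q : N => TangentSpace 𝓘(ℝ, E') q)}
  {J : ∀ q : N, TangentSpace 𝓘(ℝ, E') q →L[ℝ] TangentSpace 𝓘(ℝ, E') q} {μ : ℝ} {F : M → N}

namespace IsComplexSpaceForm

theorem sectionalCurv_writtenInExtChartAt (hN : IsComplexSpaceForm g J μ) (F : M → N) (p : M)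
    (a : E') (ha : a ≠ 0) :
    sectionalCurv (chartMetric g (F p))
      (writtenInExtChartAt 𝓘(ℝ, E) 𝓘(ℝ, E') p F (extChartAt 𝓘(ℝ, E) p p)) a
      (chartEnd J (F p) (writtenInExtChartAt 𝓘(ℝ, E) 𝓘(ℝ, E') p F (extChartAt 𝓘(ℝ, E) p p)) a)
      = μ := by
  have hFp : writtenInExtChartAt 𝓘(ℝ, E) 𝓘(ℝ, E') p F (extChartAt 𝓘(ℝ, E) p p) =
      extChartAt 𝓘(ℝ, E') (F p) (F p) := by
    simp [writtenInExtChartAt]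
  rw [hFp, chartEnd_extChartAt_self]
  exact hN.holomorphicCurv (F p) a ha

variable [FiniteDimensional ℝ E] [FiniteDimensional ℝ E'] [IsManifold 𝓘(ℝ, E) ∞ M]

theorem scalarCurvature_eq (hN : IsComplexSpaceForm g J μ)
    (hF : IsSmoothImmersion (E := E) (E' := E') F) (hreal : IsTotallyReal (E := E) g J F)
    (hmin : IsMinimal (E := E) g F) (hf : HasParallelF (E := E) g J F) (p : M) :
    scalarCurvature (E := E) g F p =
      Module.finrank ℝ E * (Module.finrank ℝ E - 1) * (μ / 4) - sffLengthSq (E := E) g F p :=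
  (hreal.isParallelTotallyRealAt hN.kahler hF hf p).scalarCurv_eq
    (hN.sectionalCurv_writtenInExtChartAt F p) (hmin p)

theorem isTotallyGeodesic_or_scalarCurvature_nonneg (hN : IsComplexSpaceForm g J μ)
    (hF : IsSmoothImmersion (E := E) (E' := E') F) (hreal : IsTotallyReal (E := E) g J F)
    (hmin : IsMinimal (E := E) g F) (hsemi : IsSemiparallel (E := E) g F)
    (hf : HasParallelF (E := E) g J F) :
    IsTotallyGeodesic (E := E) g F ∨ ∀ p : M, 0 ≤ scalarCurvature (E := E) g F p := by
  have hR := hreal.isParallelTotallyRealAt hN.kahler hF hf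
  have hS (p : M) := (hR p).sffNormSq_sq_le (hN.sectionalCurv_writtenInExtChartAt F p) (hmin p)
    (hsemi p)
  rcases lt_or_ge ((Module.finrank ℝ E * (Module.finrank ℝ E - 1) : ℝ) * (μ / 4)) 0 with hneg | hpos
  · refine Or.inl fun p => (hR p).sff_eq_zero (hmin p) (pow_eq_zero_iff two_ne_zero |>.1 ?_)
    exact ((hS p).trans (mul_nonpos_of_nonpos_of_nonneg hneg.le
      ((hR p).sffNormSq_nonneg (hmin p)))).antisymm (sq_nonneg _)
  · refine Or.inr fun p => ?_
    rw [hN.scalarCurvature_eq hF hreal hmin hf, sub_nonneg]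
    by_contra! hlt
    exact (hS p).not_gt ((mul_lt_mul_of_pos_right hlt (hpos.trans_lt hlt)).trans_eq (sq _).symm)

end IsComplexSpaceForm

end ComplexSpaceForms

end TotReal

end

theorem theorem2_general
    {E : Type*} [NormedAddCommGroup E] [NormedSpace ℝ E] [FiniteDimensional ℝ E]
    {M : Type*} [TopologicalSpace M] [ChartedSpace E M] [IsManifold 𝓘(ℝ, E) ∞ M]
    {E' : Type*} [NormedAddCommGroup E'] [NormedSpace ℝ E'] [FiniteDimensional ℝ E']
    {N : Type*} [TopologicalSpace N] [ChartedSpace E' N] [IsManifold 𝓘(ℝ, E') ∞ N]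
    (g : ContMDiffRiemannianMetric 𝓘(ℝ, E') ∞ E' (fun q : N => TangentSpace 𝓘(ℝ, E') q))
    (J : ∀ q : N, TangentSpace 𝓘(ℝ, E') q →L[ℝ] TangentSpace 𝓘(ℝ, E') q)
    (μ : ℝ) (hN : TotReal.IsComplexSpaceForm g J μ)
    (F : M → N) (hF : TotReal.IsSmoothImmersion (E := E) (E' := E') F)
    (hreal : TotReal.IsTotallyReal (E := E) g J F)
    (hmin : TotReal.IsMinimal (E := E) g F)
    (hsemi : TotReal.IsSemiparallel (E := E) g F)
    (hf : TotReal.HasParallelF (E := E) g J F) :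
    ((∃ c : ℝ, ∀ p : M, TotReal.sffLengthSq (E := E) g F p = c) ↔
      (∃ c : ℝ, ∀ p : M, TotReal.scalarCurvature (E := E) g F p = c)) ∧
    (TotReal.IsTotallyGeodesic (E := E) g F ∨
      ∀ p : M, 0 ≤ TotReal.scalarCurvature (E := E) g F p) ∧
    (∀ p : M, TotReal.scalarCurvature (E := E) g F p = 0 →
      ∀ v w z : TangentSpace 𝓘(ℝ, E) p,
        TotReal.curv (TotReal.inducedMetric (TotReal.chartMetric g (F p))
          (writtenInExtChartAt 𝓘(ℝ, E) 𝓘(ℝ, E') p F)) (extChartAt 𝓘(ℝ, E) p p) v w z = 0) := by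
  have hτ := hN.scalarCurvature_eq hF hreal hmin hf
  refine ⟨⟨fun ⟨c, hc⟩ => ⟨_, fun p => by rw [hτ, hc]⟩, fun ⟨c, hc⟩ =>
    ⟨Module.finrank ℝ E * (Module.finrank ℝ E - 1) * (μ / 4) - c, fun p => ?_⟩⟩,
    hN.isTotallyGeodesic_or_scalarCurvature_nonneg hF hreal hmin hsemi hf, fun p hp => ?_⟩
  · rw [← hc p, hτ, sub_sub_cancel]
  · exact (hreal.isParallelTotallyRealAt hN.kahler hF hf p).curv_eq_zero
      (hN.sectionalCurv_writtenInExtChartAt F p) (hmin p) (hsemi p) hp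

theorem theorem2
    {E : Type*} [NormedAddCommGroup E] [NormedSpace ℝ E] [FiniteDimensional ℝ E]
    {M : Type*} [TopologicalSpace M] [ChartedSpace E M] [IsManifold 𝓘(ℝ, E) ∞ M]
    {E' : Type*} [NormedAddCommGroup E'] [NormedSpace ℝ E'] [FiniteDimensional ℝ E']
    {N : Type*} [TopologicalSpace N] [ChartedSpace E' N] [IsManifold 𝓘(ℝ, E') ∞ N]
    (g : ContMDiffRiemannianMetric 𝓘(ℝ, E') ∞ E' (fun q : N => TangentSpace 𝓘(ℝ, E') q))
    (J : ∀ q : N, TangentSpace 𝓘(ℝ, E') q →L[ℝ] TangentSpace 𝓘(ℝ, E') q)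
    (μ : ℝ) (hN : TotReal.IsComplexSpaceForm g J μ)
    (F : M → N) (hF : TotReal.IsSmoothImmersion (E := E) (E' := E') F)
    (hreal : TotReal.IsTotallyReal (E := E) g J F)
    (hmin : TotReal.IsMinimal (E := E) g F)
    (hsemi : TotReal.IsSemiparallel (E := E) g F)
    (hf : TotReal.HasParallelF (E := E) g J F) :
    ((∃ c : ℝ, ∀ p : M, TotReal.sffLengthSq (E := E) g F p = c) ↔
      (∃ c : ℝ, ∀ p : M, TotReal.scalarCurvature (E := E) g F p = c)) ∧
    ((∃ c : ℝ, ∀ p : M, TotReal.sffLengthSq (E := E) g F p = c) →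
      (TotReal.IsTotallyGeodesic (E := E) g F ∨
        ∀ p : M, 0 ≤ TotReal.scalarCurvature (E := E) g F p) ∧
      ((∀ p : M, TotReal.scalarCurvature (E := E) g F p = 0) → TotReal.IsFlat (E := E) g F)) := by
  obtain ⟨hconst, hsign, hflat⟩ := theorem2_general g J μ hN F hF hreal hmin hsemi hf
  exact ⟨hconst, fun _ => ⟨hsign, fun hτ p => hflat p (hτ p)⟩⟩
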